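/- Let $H$ be a finitely generated abelian group, $\mathrm{Hom}(H;\mathbb{R})$ the real vector space of its real characters and $\mathrm{S}(H)=(\mathrm{Hom}(H;\mathbb{R})\setminus\{0\})/\mathbb{R}_{>0}$ its character sphere; for $Z\subseteq\mathrm{Hom}(H;\mathbb{R})$ let $\mathrm{S}(Z)\subseteq\mathrm{S}(H)$ be the image of $Z\setminus\{0\}$. *Tropical variety over a ring.* For a commutative ring $R$, $\chi\in\mathrm{Hom}(H;\mathbb{R})$ and $f=\sum a_h h\in RH$, let the initial form $\mathrm{in}_\chi(f)$ be the sum of the terms $a_h h$ with $a_h\neq 0$ for which $\chi(h)$ is minimal. For an ideal $I\subseteq RH$ let $\mathrm{in}_\chi(I)$ be the ideal generated by all $\mathrm{in}_\chi(f)$ with $f\in I$, and put $\mathrm{Trop}_R(I)=\{\chi\in\mathrm{Hom}(H;\mathbb{R})\mid \mathrm{in}_\chi(I)\neq RH\}$. *Tropical variety over a valued field.* Let $\Bbbk$ be a field with a (possibly trivial) valuation $v\colon\Bbbk\to\mathbb{R}\cup\{\infty\}$. For an ideal $J\subseteq\Bbbk\mathbb{Z}^n=\Bbbk[x_1^{\pm1},\dots,x_n^{\pm1}]$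 let $\mathrm{Trop}_{\Bbbk,v}(J)$ be the set of $w\in\mathrm{Hom}(\mathbb{Z}^n;\mathbb{R})=\mathbb{R}^n$ such that for every nonzero $f=\sum a_u x^u\in J$ the minimum $\min\{v(a_u)+w(u)\mid a_u\neq 0\}$ is attained for at least two $u$. For an ideal $J\subseteq\Bbbk H$ choose an epimorphism $\psi\colon\mathbb{Z}^n\to H$, let $\tilde J\subseteq\Bbbk\mathbb{Z}^n$ be the preimage of $J$, and put $\mathrm{Trop}_{\Bbbk,v}(J)=\{\chi\in\mathrm{Hom}(H;\mathbb{R})\mid\chi\circ\psi\in\mathrm{Trop}_{\Bbbk,v}(\tilde J)\}$; this does not depend on $\psi$. For an ideal $I\subseteq\mathbb{Z}H$ and a field $\Bbbk$, write $I\otimes\Bbbk$ for the ideal of $\Bbbk H$ generated by the image of $I$. Let $v_0$ be the trivial valuation on $\mathbb{Q}$, $v_p$ the $p$-adic valuation on $\mathbb{Q}$, and $\hat v_p$ the trivial valuation on $\mathbb{F}_p$. **Proposition.** For every ideal $I\subseteq\mathbb{Z}H$, $$\mathrm{S}\big(\mathrm{Trop}_{\mathbb{Z}}(I)\big)=\mathrm{S}\Big(\mathrm{Trop}_{\mathbb{Q},v_0}(I\otimes\mathbb{Q})\cup\bigcup_{p\in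 P}\big(\mathrm{Trop}_{\mathbb{Q},v_p}(I\otimes\mathbb{Q})\cup\mathrm{Trop}_{\mathbb{F}_p,\hat v_p}(I\otimes\mathbb{F}_p)\big)\Big)$$ holds when $P$ is the set of all primes, and it also holds for some finite set $P$ of primes (depending on $I$). -/

import Mathlib

noncomputable section

open Classical

/-! ### The character sphere -/

/-- The sphere `S(H) = (Hom(H, ℝ) - {0}) / ℝ⁺` of an (additively written) abelian group `H`;
`Module.Ray ℝ V` is the quotient of the nonzero vectors of `V` by positive scalings. -/
abbrev CharSphere (H : Type*) [AddCommGroup H] : Type _ := Module.Ray ℝ (H →+ ℝ)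

/-- `S(Z)`: the image of `Z - {0}` in `S(H)`. -/
def sphereProj {H : Type*} [AddCommGroup H] (Z : Set (H →+ ℝ)) : Set (CharSphere H) :=
  {r | ∃ (χ : H →+ ℝ) (hχ : χ ≠ 0), χ ∈ Z ∧ rayOfNeZero ℝ χ hχ = r}

/-! ### The tropical variety over a ring -/

section Ring

variable {R : Type*} [CommRing R] {H : Type*} [AddCommGroup H]

/-- The initial form `in_χ(f)`: the sum of all terms `a_h h` of `f` (with `a_h ≠ 0`) for which
`χ h` is minimal, i.e. equal to the `χ`-degree of `f`. -/
def initialForm (χ : H →+ ℝ) (f : AddMonoidAlgebra R H) : AddMonoidAlgebra R H :=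
  AddMonoidAlgebra.ofCoeff (f.coeff.filter fun h => ∀ g ∈ f.coeff.support, χ h ≤ χ g)

/-- The initial ideal `in_χ(I)`, generated by the initial forms of the elements of `I`. -/
def initialIdeal (χ : H →+ ℝ) (I : Ideal (AddMonoidAlgebra R H)) : Ideal (AddMonoidAlgebra R H) :=
  Ideal.span (initialForm χ '' (I : Set (AddMonoidAlgebra R H)))

/-- The tropical variety `Trop_R(I)` over the ring `R`. -/
def tropRing (I : Ideal (AddMonoidAlgebra R H)) : Set (H →+ ℝ) :=
  {χ | initialIdeal χ I ≠ ⊤}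

end Ring

/-! ### The tropical variety over a valued field -/

section Field

variable {k : Type*} [Field k] (v : AddValuation k (WithTop ℝ))

/-- The term `v(a_u) + w(u)` of the tropical polynomial of `f = ∑ a_u x^u`. -/
def tropTerm {G : Type*} [AddCommGroup G] (f : AddMonoidAlgebra k G) (w : G →+ ℝ) (u : G) :
    WithTop ℝ :=
  v (f.coeff u) + (w u : WithTop ℝ)

/-- The tropical polynomial `w ↦ min {v(a_u) + w(u) | a_u ≠ 0}` of `f = ∑ a_u x^u`. -/
def tropPoly {G : Type*} [AddCommGroup G] (f : AddMonoidAlgebra k G) (w : G →+ ℝ) : WithTop ℝ :=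
  f.coeff.support.inf (tropTerm v f w)

/-- The tropical hypersurface of `f`: the minimum in the tropical polynomial is achieved at
least twice. -/
def tropHypersurface {G : Type*} [AddCommGroup G] (f : AddMonoidAlgebra k G) : Set (G →+ ℝ) :=
  {w | ∃ u ∈ f.coeff.support, ∃ u' ∈ f.coeff.support, u ≠ u' ∧
    tropTerm v f w u = tropPoly v f w ∧ tropTerm v f w u' = tropPoly v f w}

/-- The tropical variety of an ideal of the Laurent polynomial ring `k[ℤⁿ]`, as a subset of
`Hom(ℤⁿ, ℝ) = ℝⁿ`. -/
def tropLaurent {n : ℕ} (I : Ideal (AddMonoidAlgebra k (Fin n → ℤ))) :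
    Set ((Fin n → ℤ) →+ ℝ) :=
  {w | ∀ f ∈ I, f ≠ 0 → w ∈ tropHypersurface v f}

variable {H : Type*} [AddCommGroup H]

/-- For a homomorphism `ψ : ℤⁿ → H`, the preimage in `k[ℤⁿ]` of an ideal of `k[H]`. -/
def liftIdeal {n : ℕ} (ψ : (Fin n → ℤ) →+ H) (I : Ideal (AddMonoidAlgebra k H)) :
    Ideal (AddMonoidAlgebra k (Fin n → ℤ)) :=
  I.comap (AddMonoidAlgebra.mapDomainRingHom k ψ)

/-- The tropical variety `Trop_{k,v}(I) ⊆ Hom(H, ℝ)` of an ideal `I` of `k[H]`, for a finitely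
generated abelian group `H`: a character `χ` belongs to it if `ψ^*χ` belongs to the tropical
variety of the preimage of `I` in `k[ℤⁿ]`, where `ψ : ℤⁿ → H` is an epimorphism.
This does not depend on `ψ`: see `tropField_eq`. -/
def tropField (I : Ideal (AddMonoidAlgebra k H)) : Set (H →+ ℝ) :=
  {χ | ∀ (n : ℕ) (ψ : (Fin n → ℤ) →+ H), Function.Surjective ψ →
    χ.comp ψ ∈ tropLaurent v (liftIdeal ψ I)}

theorem tropTerm_ne_top {G : Type*} [AddCommGroup G] (f : AddMonoidAlgebra k G) (w : G →+ ℝ)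
    {u : G} (hu : u ∈ f.coeff.support) : tropTerm v f w u ≠ ⊤ := by
  unfold tropTerm
  rw [Ne, WithTop.add_eq_top, not_or]
  refine ⟨?_, WithTop.coe_ne_top⟩
  rw [AddValuation.top_iff]
  exact Finsupp.mem_support_iff.mp hu

theorem comp_mem_tropLaurent_iff {n : ℕ} (ψ : (Fin n → ℤ) →+ H) (hψ : Function.Surjective ψ)
    (I : Ideal (AddMonoidAlgebra k H)) (χ : H →+ ℝ) :
    χ.comp ψ ∈ tropLaurent v (liftIdeal ψ I) ↔
      ∀ f ∈ I, f ≠ 0 → χ ∈ tropHypersurface v f := by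
  constructor
  · intro hw f hf hf0
    obtain ⟨s, hs⟩ := hψ.hasRightInverse
    have hsi : Function.Injective s := hs.injective
    set F : AddMonoidAlgebra k (Fin n → ℤ) :=
      AddMonoidAlgebra.ofCoeff (f.coeff.mapDomain s) with hF
    have hFs : F.coeff.support = f.coeff.support.image s := by
      rw [hF]; exact Finsupp.mapDomain_support_of_injective hsi _
    have hFt : ∀ h, tropTerm v F (χ.comp ψ) (s h) = tropTerm v f χ h := by
      intro h
      have h1 : F.coeff (s h) = f.coeff h := by
        rw [hF]; exact Finsupp.mapDomain_apply hsi _ _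
      simp only [tropTerm, h1, AddMonoidHom.comp_apply, hs h]
    have hFp : tropPoly v F (χ.comp ψ) = tropPoly v f χ := by
      unfold tropPoly
      rw [hFs, Finset.inf_image]
      exact Finset.inf_congr rfl fun h _ => hFt h
    have hmap : AddMonoidAlgebra.mapDomainRingHom k ψ F = f := by
      apply AddMonoidAlgebra.coeff_injective
      change Finsupp.mapDomain ψ (Finsupp.mapDomain s f.coeff) = f.coeff
      rw [← Finsupp.mapDomain_comp, hs.comp_eq_id, Finsupp.mapDomain_id]
    have hFI : F ∈ liftIdeal ψ I := by
      rw [liftIdeal, Ideal.mem_comap, hmap]; exact hf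
    have hF0 : F ≠ 0 := by
      intro h0
      rw [h0, map_zero] at hmap
      exact hf0 hmap.symm
    obtain ⟨u, hu, u', hu', hne, h1, h2⟩ := hw F hFI hF0
    rw [hFs, Finset.mem_image] at hu hu'
    obtain ⟨h, hh, rfl⟩ := hu
    obtain ⟨h', hh', rfl⟩ := hu'
    rw [hFt, hFp] at h1 h2
    exact ⟨h, hh, h', hh', fun e => hne (congrArg s e), h1, h2⟩
  · intro hD F hF hF0
    by_contra hcon
    set w := χ.comp ψ with hw
    have hne : F.coeff.support.Nonempty := by
      rw [Finsupp.support_nonempty_iff]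
      exact fun h => hF0 (AddMonoidAlgebra.coeff_injective h)
    obtain ⟨u, hu, hmin⟩ := Finset.exists_mem_eq_inf F.coeff.support hne (tropTerm v F w)
    have hlt : ∀ u' ∈ F.coeff.support, u' ≠ u → tropTerm v F w u < tropTerm v F w u' := by
      intro u' hu' hn
      refine lt_of_le_of_ne (hmin ▸ Finset.inf_le hu') fun he => hcon ?_
      exact ⟨u, hu, u', hu', hn.symm, hmin.symm, (he ▸ hmin).symm⟩
    set f := AddMonoidAlgebra.mapDomainRingHom k ψ F with hf
    have hfc : ∀ h, f.coeff h = ∑ u' ∈ F.coeff.support with ψ u' = h, F.coeff u' := by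
      intro h
      change (Finsupp.mapDomain ψ F.coeff) h = _
      rw [Finsupp.mapDomain, Finsupp.sum_apply, Finsupp.sum, Finset.sum_filter]
      exact Finset.sum_congr rfl fun a _ => Finsupp.single_apply
    have hval : ∀ (S : Finset (Fin n → ℤ)) (h : H), S ⊆ F.coeff.support →
        (∀ u' ∈ S, u' ≠ u ∧ ψ u' = h) →
        tropTerm v F w u < v (∑ u' ∈ S, F.coeff u') + ((χ h : ℝ) : WithTop ℝ) := by
      intro S h hS hS'
      by_cases hSe : S.Nonempty
      · have hle : S.inf (fun u' => v (F.coeff u')) ≤ v (∑ u' ∈ S, F.coeff u') :=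
          AddValuation.map_le_sum v fun i hi => Finset.inf_le hi
        obtain ⟨a, ha, hae⟩ := Finset.exists_mem_eq_inf S hSe (fun u' => v (F.coeff u'))
        have h1 := hlt a (hS ha) (hS' a ha).1
        refine lt_of_lt_of_le h1 ?_
        have h2 : tropTerm v F w a = v (F.coeff a) + ((χ h : ℝ) : WithTop ℝ) := by
          rw [tropTerm, hw, AddMonoidHom.comp_apply, (hS' a ha).2]
        rw [h2]
        rw [hae] at hle
        gcongr
      · rw [Finset.not_nonempty_iff_eq_empty] at hSe
        subst hSe
        rw [Finset.sum_empty, AddValuation.map_zero, WithTop.top_add]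
        exact lt_top_iff_ne_top.mpr (tropTerm_ne_top v F w hu)
    have hother : ∀ h, h ≠ ψ u → tropTerm v F w u < tropTerm v f χ h := by
      intro h hh
      rw [tropTerm.eq_def v f, hfc]
      refine hval _ h (Finset.filter_subset _ _) fun u' hu' => ?_
      have := (Finset.mem_filter.mp hu').2
      exact ⟨fun e => hh (by rw [← this, e]), this⟩
    have hmain : tropTerm v f χ (ψ u) = tropTerm v F w u := by
      have hum : u ∈ F.coeff.support.filter fun u' => ψ u' = ψ u :=
        Finset.mem_filter.mpr ⟨hu, rfl⟩
      have hlt' := hval ((F.coeff.support.filter fun u' => ψ u' = ψ u).erase u) (ψ u)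
        ((Finset.erase_subset _ _).trans (Finset.filter_subset _ _)) fun u' hu' =>
          ⟨Finset.ne_of_mem_erase hu', (Finset.mem_filter.mp (Finset.mem_of_mem_erase hu')).2⟩
      have hlt2 : v (F.coeff u) <
          v (∑ u' ∈ (F.coeff.support.filter fun u' => ψ u' = ψ u).erase u, F.coeff u') :=
        lt_of_add_lt_add_right (a := ((χ (ψ u) : ℝ) : WithTop ℝ)) hlt'
      rw [tropTerm, tropTerm, hfc, ← Finset.add_sum_erase _ _ hum,
        AddValuation.map_add_eq_of_lt_left v hlt2]
      rfl
    have hfne : f.coeff (ψ u) ≠ 0 := by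
      intro h0
      apply tropTerm_ne_top v F w hu
      rw [← hmain, tropTerm, h0, AddValuation.map_zero, WithTop.top_add]
    have hf0 : f ≠ 0 := fun h0 => hfne (by rw [h0]; rfl)
    have hpoly : tropPoly v f χ ≤ tropTerm v F w u := by
      rw [← hmain]
      exact Finset.inf_le (Finsupp.mem_support_iff.mpr hfne)
    obtain ⟨a, -, b, -, hab, h1, h2⟩ := hD f hF hf0
    have ha : a = ψ u := by
      by_contra hc
      exact absurd (hother a hc) (not_lt.mpr (h1 ▸ hpoly))
    have hb : b = ψ u := by
      by_contra hc
      exact absurd (hother b hc) (not_lt.mpr (h2 ▸ hpoly))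
    exact hab (ha.trans hb.symm)

/-- The tropical variety of `I` may be computed with any epimorphism `ψ : ℤⁿ → H`. -/
theorem tropField_eq {n : ℕ} (ψ : (Fin n → ℤ) →+ H) (hψ : Function.Surjective ψ)
    (I : Ideal (AddMonoidAlgebra k H)) :
    tropField v I = {χ | χ.comp ψ ∈ tropLaurent v (liftIdeal ψ I)} := by
  ext χ
  constructor
  · intro h
    exact h n ψ hψ
  · intro h m φ hφ
    exact (comp_mem_tropLaurent_iff v φ hφ I χ).mpr ((comp_mem_tropLaurent_iff v ψ hψ I χ).mp h)

end Field

/-! ### The valuations -/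

/-- The trivial valuation on a field: `0 ↦ ∞`, and every nonzero element goes to `0`. -/
def trivialVal (k : Type*) [Field k] : AddValuation k (WithTop ℝ) :=
  AddValuation.of (fun x => if x = 0 then ⊤ else 0) (by simp) (by simp)
    (by
      intro x y
      by_cases hx : x = 0
      · simp [hx]
      · by_cases hy : y = 0
        · simp [hy]
        · simp only [hx, hy, if_false, min_self]
          split_ifs <;> simp)
    (by
      intro x y
      by_cases hx : x = 0
      · simp [hx]
      · by_cases hy : y = 0 <;> simp [hx, hy])

instance factPrimeOfPrimes (p : Nat.Primes) : Fact (p : ℕ).Prime := ⟨p.2⟩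

/-- The `p`-adic valuation on `ℚ`, normalised by `v_p(p) = 1`. -/
def padicVal (p : Nat.Primes) : AddValuation ℚ (WithTop ℝ) :=
  AddValuation.of (fun x => if x = 0 then ⊤ else (((padicValRat p x : ℤ) : ℝ) : WithTop ℝ))
    (by simp) (by simp)
    (by
      intro x y
      by_cases hx : x = 0
      · simp [hx]
      · by_cases hy : y = 0
        · simp [hy]
        · by_cases hxy : x + y = 0
          · simp [hxy]
          · have h := padicValRat.min_le_padicValRat_add (p := (p : ℕ)) hxy
            simp only [hx, hy, hxy, if_false]
            rw [min_le_iff] at h ⊢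
            simpa only [WithTop.coe_le_coe, Int.cast_le] using h)
    (by
      intro x y
      by_cases hx : x = 0
      · simp [hx]
      · by_cases hy : y = 0
        · simp [hy]
        · simp only [hx, hy, mul_eq_zero, or_self, if_false]
          rw [padicValRat.mul hx hy]
          push_cast
          rfl)

/-! ### Change of coefficients and the union of tropical varieties -/

/-- For an ideal `I` of `ℤ[H]`, the ideal `I ⊗ k` of `k[H] = ℤ[H] ⊗ k`, i.e. the ideal of `k[H]`
generated by the image of `I`. -/
def extendIdeal {H : Type*} [AddCommGroup H] (k : Type*) [Field k]
    (I : Ideal (AddMonoidAlgebra ℤ H)) : Ideal (AddMonoidAlgebra k H) :=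
  I.map (AddMonoidAlgebra.mapRingHom H (Int.castRingHom k))

/-- The union of `Trop_{ℚ,v₀}(I ⊗ ℚ)` with the sets `Trop_{ℚ,v_p}(I ⊗ ℚ)` and
`Trop_{𝔽_p}(I ⊗ 𝔽_p)` (trivial valuation on `𝔽_p`), where `p` runs over a set `P` of primes. -/
def tropUnion {H : Type*} [AddCommGroup H] (I : Ideal (AddMonoidAlgebra ℤ H))
    (P : Set Nat.Primes) : Set (H →+ ℝ) :=
  tropField (trivialVal ℚ) (extendIdeal ℚ I) ∪
    ⋃ p ∈ P, (tropField (padicVal p) (extendIdeal ℚ I) ∪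
      tropField (trivialVal (ZMod p)) (extendIdeal (ZMod p) I))

end

/-! A character χ lies outside `tropRing I` exactly when I contains some f = 1 + (terms of positive
χ-degree). Such an f has 1 as its only minimal term over ℚ trivially valued, over ℚ with v_p
(integer coefficients have nonnegative valuation) and over 𝔽_p. So the union of field tropical
varieties lies in `tropRing I`, for any set of primes.

For the converse up to scaling, let χ ≠ 0 lie in `tropRing I`. Then I misses the multiplicative set
of all such f, hence lies in a prime ideal P missing it. In the fraction field of ℤ[H]/P, the images
of the elements of positive degree form a proper ideal in the image of those of nonnegative degree,
so some valuation ring dominates the pair. Its valuation gives N on ℤ and W on H, with values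
written multiplicatively (high degree means small value). Elements of I map to 0, so none has a
dominant term. Fix h₀ with χ(h₀) > 0 and compare W(h₀) with N(p). If W(h₀) is below every power of
every N(p), coefficients are negligible and χ is tropical for trivially valued ℚ. If some N(p) is
below every power of W(h₀), then p is negligible and χ is tropical over 𝔽_p. Otherwise some N(p) is
commensurable with W(h₀) and acts as an element of real degree t > 0, so χ/t is tropical for v_p.
This rescaling is why the statement concerns rays.

Finitely many primes suffice because over ℚ, for all χ at once, unique minima can be tested on
supports inside one finite set T (`exists_finset_support_hasUniqueMin`). For each S ⊆ T and m ∈ T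
one integral witness then serves, and only primes dividing its coefficient at m matter. The
existence of T follows from an ultraproduct argument: characters with no common T yield a
hyperreal-valued character, whose leading forms on homogeneous elements are finitely generated by
Noetherianity. They are therefore controlled by finitely many comparisons, which some of the real
characters share. -/

noncomputable section

open Classical

/-! ### Leading parts -/

/-- `v` has no terms of `χ`-degree smaller than `δ`, and `y` is its part of degree `δ`. -/
def IsLeadingPart {M Γ k : Type*} [Zero k] [LT Γ] (χ : M → Γ) (δ : Γ) (v y : M →₀ k) : Prop :=
  (∀ m, χ m < δ → v m = 0) ∧ (∀ m, χ m = δ → y m = v m) ∧ ∀ m, χ m ≠ δ → y m = 0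

section LeadingPart

variable {M Γ Γ' k : Type*} [Field k] [LinearOrder Γ] [LinearOrder Γ']

theorem IsLeadingPart.sum_smul {χ : M → Γ} {δ : Γ} {ι : Type*} {s : Finset ι} {c : ι → k}
    {w y : ι → M →₀ k} (h : ∀ i ∈ s, IsLeadingPart χ δ (w i) (y i)) :
    IsLeadingPart χ δ (∑ i ∈ s, c i • w i) (∑ i ∈ s, c i • y i) := by
  refine ⟨fun m hm => ?_, fun m hm => ?_, fun m hm => ?_⟩ <;>
    simp only [Finsupp.finsetSum_apply, Finsupp.smul_apply]
  · exact Finset.sum_eq_zero fun i hi => by rw [(h i hi).1 m hm, smul_zero]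
  · exact Finset.sum_congr rfl fun i hi => by rw [(h i hi).2.1 m hm]
  · exact Finset.sum_eq_zero fun i hi => by rw [(h i hi).2.2 m hm, smul_zero]

theorem IsLeadingPart.sub {χ : M → Γ} {δ : Γ} {v v' y y' : M →₀ k}
    (h : IsLeadingPart χ δ v y) (h' : IsLeadingPart χ δ v' y') :
    IsLeadingPart χ δ (v - v') (y - y') := by
  refine ⟨fun m hm => ?_, fun m hm => ?_, fun m hm => ?_⟩ <;> simp only [Finsupp.sub_apply]
  · rw [h.1 m hm, h'.1 m hm, sub_zero]
  · rw [h.2.1 m hm, h'.2.1 m hm]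
  · rw [h.2.2 m hm, h'.2.2 m hm, sub_zero]

theorem IsLeadingPart.zero_of_lt {χ : M → Γ} {δ δ' : Γ} {v y : M →₀ k}
    (h : IsLeadingPart χ δ v y) (hlt : δ' < δ) : IsLeadingPart χ δ' v 0 :=
  ⟨fun m hm => h.1 m (hm.trans hlt), fun m hm => (h.1 m (hm ▸ hlt)).symm, fun _ _ => rfl⟩

theorem IsLeadingPart.unique {χ : M → Γ} {δ δ' : Γ} {v y y' : M →₀ k}
    (h : IsLeadingPart χ δ v y) (h' : IsLeadingPart χ δ' v y') (hy : y ≠ 0) (hy' : y' ≠ 0) :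
    y = y' := by
  have key : ∀ {δ δ' : Γ} {y y' : M →₀ k}, IsLeadingPart χ δ v y → IsLeadingPart χ δ' v y' →
      y ≠ 0 → δ' ≤ δ := by
    intro δ δ' y y' h h' hy
    obtain ⟨m, hm⟩ := Finsupp.ne_iff.mp hy
    have hd : χ m = δ := by_contra fun hc => hm (h.2.2 m hc)
    by_contra hc
    exact hm ((h.2.1 m hd).trans (h'.1 m (hd ▸ not_le.mp hc)))
  obtain rfl : δ = δ' := le_antisymm (key h' h hy') (key h h' hy)
  ext m
  by_cases hm : χ m = δ
  · rw [h.2.1 m hm, h'.2.1 m hm]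
  · rw [h.2.2 m hm, h'.2.2 m hm]

theorem exists_isLeadingPart (χ : M → Γ) {v : M →₀ k} (hv : v ≠ 0) :
    ∃ m, v m ≠ 0 ∧ IsLeadingPart χ (χ m) v (v.filter fun m' => χ m' = χ m) := by
  obtain ⟨m, hm, hmin⟩ := Finset.exists_min_image v.support χ (Finsupp.support_nonempty_iff.mpr hv)
  refine ⟨m, Finsupp.mem_support_iff.mp hm, fun m' hm' => ?_, fun m' hm' => ?_, fun m' hm' => ?_⟩
  · by_contra hc
    exact not_le.mpr hm' (hmin m' (Finsupp.mem_support_iff.mpr hc))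
  · exact Finsupp.filter_apply_pos (fun m' => χ m' = χ m) v hm'
  · exact Finsupp.filter_apply_neg (fun m' => χ m' = χ m) v hm'

/-- Parts of distinct degrees have disjoint supports, so in a combination concentrated in degree δ
the summands of other degrees cancel among themselves and can be dropped. -/
theorem IsLeadingPart.sum_filter {χ : M → Γ} {ι : Type*} {s : Finset ι} {c : ι → k}
    {w y : ι → M →₀ k} {d : ι → Γ} (h : ∀ i ∈ s, IsLeadingPart χ (d i) (w i) (y i)) {δ : Γ}
    {z : M →₀ k} (hz : z = ∑ i ∈ s, c i • y i) (hδ : ∀ m, χ m ≠ δ → z m = 0) :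
    IsLeadingPart χ δ (∑ i ∈ s with d i = δ, c i • w i) z := by
  have h1 : IsLeadingPart χ δ (∑ i ∈ s with d i = δ, c i • w i)
      (∑ i ∈ s with d i = δ, c i • y i) :=
    IsLeadingPart.sum_smul fun i hi => by
      obtain ⟨his, hid⟩ := Finset.mem_filter.mp hi
      exact hid ▸ h i his
  convert h1
  ext m
  by_cases hm : χ m = δ
  · rw [hz, Finsupp.finsetSum_apply, Finsupp.finsetSum_apply, Finset.sum_filter]
    refine Finset.sum_congr rfl fun i hi => ?_
    split_ifs with hd
    · rfl
    · rw [Finsupp.smul_apply, (h i hi).2.2 m fun e => hd (e.symm.trans hm), smul_zero]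
  · rw [hδ m hm, h1.2.2 m hm]

/-- Elements whose leading parts span all leading parts of `V` span `V`. -/
theorem le_span_of_leadingPart {χ : M → Γ} {V : Submodule k (M →₀ k)} {T : Finset M}
    (hT : ∀ v ∈ V, v.support ⊆ T) {ι : Type*} {w y : ι → M →₀ k} (hw : ∀ i, w i ∈ V)
    {d : ι → Γ} (hd : ∀ i, IsLeadingPart χ (d i) (w i) (y i))
    (hspan : ∀ v ∈ V, ∀ δ z, IsLeadingPart χ δ v z → z ∈ Submodule.span k (Set.range y)) :
    V ≤ Submodule.span k (Set.range w) := by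
  -- The measure counts the points of T at or above the lowest degree of v. Cancelling the leading
  -- part of v raises that degree, and the point m₀ drops out.
  suffices H : ∀ n, ∀ v ∈ V, (T.filter fun t => ∃ m, v m ≠ 0 ∧ χ m ≤ χ t).card = n →
      v ∈ Submodule.span k (Set.range w) from fun v hv => H _ v hv rfl
  intro n
  induction n using Nat.strong_induction_on with
  | _ n ih =>
  intro v hv hn
  by_cases hv0 : v = 0
  · rw [hv0]; exact Submodule.zero_mem _
  obtain ⟨m₀, hm₀, hlead⟩ := exists_isLeadingPart χ hv0
  obtain ⟨c, hc⟩ := Finsupp.mem_span_range_iff_exists_finsupp.mp (hspan v hv _ _ hlead)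
  have hu := IsLeadingPart.sum_filter (fun i _ => hd i) hc.symm hlead.2.2
  set u := ∑ i ∈ c.support with d i = χ m₀, c i • w i with hu_def
  have huV : u ∈ V := Submodule.sum_mem _ fun i _ => V.smul_mem _ (hw i)
  have huS : u ∈ Submodule.span k (Set.range w) :=
    Submodule.sum_mem _ fun i _ => Submodule.smul_mem _ _ (Submodule.subset_span ⟨i, rfl⟩)
  have hsub := hlead.sub hu
  rw [sub_self] at hsub
  have hgt : ∀ m, (v - u) m ≠ 0 → χ m₀ < χ m := fun m hm => by
    by_contra hle
    rcases (not_lt.mp hle).lt_or_eq with h | h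
    · exact hm (hsub.1 m h)
    · exact hm (hsub.2.1 m h).symm
  have hvu := ih _ ?_ (v - u) (V.sub_mem hv huV) rfl
  · simpa using Submodule.add_mem _ hvu huS
  · rw [← hn]
    refine Finset.card_lt_card ⟨fun t ht => ?_, fun hss => ?_⟩
    · obtain ⟨htT, m, hm, hmt⟩ := Finset.mem_filter.mp ht
      exact Finset.mem_filter.mpr ⟨htT, m₀, hm₀, ((hgt m hm).trans_le hmt).le⟩
    · obtain ⟨-, m, hm, hmt⟩ := Finset.mem_filter.mp (hss (Finset.mem_filter.mpr
        ⟨hT v hv (Finsupp.mem_support_iff.mpr hm₀), m₀, hm₀, le_rfl⟩))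
      exact not_le.mpr (hgt m hm) hmt

/-- If the leading parts of `V` with respect to `χ` are spanned by elements that are also leading
parts with respect to `χ'`, then a monomial leading part with respect to `χ'` is one with
respect to `χ`. -/
theorem exists_isLeadingPart_single {χ : M → Γ} {χ' : M → Γ'} {V : Submodule k (M →₀ k)}
    {T : Finset M} (hT : ∀ v ∈ V, v.support ⊆ T) {G : Set (M →₀ k)}
    (hG : ∀ y ∈ G, ∃ w ∈ V, (∃ δ, IsLeadingPart χ δ w y) ∧ ∃ δ, IsLeadingPart χ' δ w y)
    (hspan : ∀ v ∈ V, ∀ δ z, IsLeadingPart χ δ v z → z ∈ Submodule.span k G)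
    {f : M →₀ k} (hf : f ∈ V) {δ : Γ'} {m : M} {a : k} (ha : a ≠ 0)
    (hlead : IsLeadingPart χ' δ f (Finsupp.single m a)) :
    ∃ g ∈ V, IsLeadingPart χ (χ m) g (Finsupp.single m a) := by
  -- Linear independence prevents cancellation among χ'-leading parts: the part of lowest χ'-degree
  -- in a combination of lifts is nonzero, hence is the leading part.
  obtain ⟨B, hBG, hBspan, hBli⟩ := exists_linearIndependent k G
  choose w hwV hw hw' using fun y : B => hG y (hBG y.2)
  choose d hd using hw
  choose d' hd' using hw'
  have hle : V ≤ Submodule.span k (Set.range w) :=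
    le_span_of_leadingPart (y := fun y : B => (y : M →₀ k)) hT hwV hd fun v hv δ z hz => by
      rw [Subtype.range_coe, hBspan]
      exact hspan v hv δ z hz
  obtain ⟨c, hc⟩ := Finsupp.mem_span_range_iff_exists_finsupp.mp (hle hf)
  rw [Finsupp.sum] at hc
  have hz0 : Finsupp.single m a ≠ 0 := Finsupp.single_ne_zero.mpr ha
  have hc0 : c.support.Nonempty := by
    rw [Finsupp.support_nonempty_iff]
    rintro rfl
    obtain ⟨h1, h2, h3⟩ := hlead
    have hf0 : f = 0 := by rw [← hc]; simp
    apply hz0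
    ext m'
    by_cases hm' : χ' m' = δ
    · rw [h2 m' hm', hf0]
    · rw [h3 m' hm']; rfl
  obtain ⟨y₀, hy₀, hmin⟩ := Finset.exists_min_image c.support d' hc0
  set z : M →₀ k := ∑ y ∈ c.support with d' y = d' y₀, c y • (y : M →₀ k) with hz
  have hzlead : IsLeadingPart χ' (d' y₀) f z := by
    have h1 : IsLeadingPart χ' (d' y₀) (∑ y ∈ c.support, c y • w y)
        (∑ y ∈ c.support, c y • (if d' y = d' y₀ then (y : M →₀ k) else 0)) :=
      IsLeadingPart.sum_smul fun y hy => by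
        split_ifs with hyd
        · exact hyd ▸ hd' y
        · exact (hd' y).zero_of_lt (lt_of_le_of_ne (hmin y hy) (Ne.symm hyd))
    rw [hc] at h1
    have h2 : z = ∑ y ∈ c.support, c y • (if d' y = d' y₀ then (y : M →₀ k) else 0) := by
      rw [hz, Finset.sum_filter]
      exact Finset.sum_congr rfl fun y _ => by split_ifs <;> simp
    rwa [← h2] at h1
  have hzne : z ≠ 0 := fun h0 => by
    have := linearIndependent_iff'.mp hBli _ c h0 y₀ (Finset.mem_filter.mpr ⟨hy₀, rfl⟩)
    exact Finsupp.mem_support_iff.mp hy₀ this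
  have hzs : Finsupp.single m a = z := hlead.unique hzlead hz0 hzne
  -- The same expression of the monomial through basis elements is now read with χ; only the lifts
  -- of χ-degree χ m are kept.
  refine ⟨_, ?_, IsLeadingPart.sum_filter (s := c.support.filter fun y => d' y = d' y₀) (c := c)
    (fun y _ => hd y) (hzs.trans hz) fun m' hm' => Finsupp.single_eq_of_ne ?_⟩
  · exact Submodule.sum_mem _ fun y _ => V.smul_mem _ (hwV y)
  · rintro rfl; exact hm' rfl

end LeadingPart

/-! ### Unique minima and finitely supported tropical bases -/

/-- The minimum of `χ` on the support of `f` is attained exactly once. -/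
def HasUniqueMin {M Γ k : Type*} [Zero k] [LT Γ] (χ : M → Γ) (f : M →₀ k) : Prop :=
  ∃ m, f m ≠ 0 ∧ ∀ m', f m' ≠ 0 → m' ≠ m → χ m < χ m'

section UniqueMin

variable {M N Γ k : Type*} [Field k] [LinearOrder Γ]

theorem hasUniqueMin_iff {χ : M → Γ} {f : M →₀ k} :
    HasUniqueMin χ f ↔
      ∃ m a, a ≠ 0 ∧ IsLeadingPart χ (χ m) f (Finsupp.single m a) := by
  constructor
  · rintro ⟨m, hm, h⟩
    refine ⟨m, f m, hm, fun m' hm' => ?_, fun m' hm' => ?_, fun m' hm' => ?_⟩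
    · by_contra hc
      exact lt_asymm hm' (h m' hc fun e => lt_irrefl _ (e ▸ hm'))
    · by_cases e : m' = m
      · rw [e, Finsupp.single_eq_same]
      · rw [Finsupp.single_eq_of_ne e]
        by_contra hc
        exact (h m' (Ne.symm hc) e).ne hm'.symm
    · exact Finsupp.single_eq_of_ne fun e => hm' (by rw [e])
  · rintro ⟨m, a, ha, h1, h2, -⟩
    refine ⟨m, ?_, fun m' hm' hne => ?_⟩
    · rw [← h2 m rfl, Finsupp.single_eq_same]; exact ha
    · by_contra hc
      rcases (not_lt.mp hc).lt_or_eq with h | h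
      · exact hm' (h1 m' h)
      · exact hm' ((h2 m' h).symm.trans (Finsupp.single_eq_of_ne hne))

/-- Another support point over σ m would tie with m, so nothing cancels the minimal term. -/
theorem HasUniqueMin.mapDomain {χ : N → Γ} {σ : M → N} {f : M →₀ k}
    (h : HasUniqueMin (fun m => χ (σ m)) f) : HasUniqueMin χ (f.mapDomain σ) := by
  obtain ⟨m, hm, hmin⟩ := h
  refine ⟨σ m, ?_, fun n hn hne => ?_⟩
  · have : f.mapDomain σ (σ m) = f m := by
      rw [Finsupp.mapDomain, Finsupp.sum_apply, Finsupp.sum,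
        Finset.sum_eq_single m (fun b hb hbm => ?_) fun hc => ?_]
      · exact Finsupp.single_eq_same
      · refine Finsupp.single_eq_of_ne fun e => ?_
        have := hmin b (Finsupp.mem_support_iff.mp hb) hbm
        simp [e] at this
      · rw [Finsupp.notMem_support_iff.mp hc, Finsupp.single_zero]; rfl
    rwa [this]
  · obtain ⟨m', hm', rfl⟩ := Finset.mem_image.mp
      (Finsupp.mapDomain_support (Finsupp.mem_support_iff.mpr hn))
    exact hmin m' (Finsupp.mem_support_iff.mp hm') fun e => hne (by rw [e])

end UniqueMin

/-! ### Finite generation of leading forms of a homogeneous family. -/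

section Homogeneous

variable {ι k Γ : Type*} [Field k]

/-- The homogeneous elements of degree `d` of an ideal of a polynomial ring. -/
def homogeneousPart (P : Ideal (AddMonoidAlgebra k (ι →₀ ℕ))) (d : ℕ) :
    Submodule k ((ι →₀ ℕ) →₀ k) where
  carrier := {F | (∀ m, F m ≠ 0 → m.degree = d) ∧ AddMonoidAlgebra.ofCoeff F ∈ P}
  zero_mem' := ⟨fun m hm => absurd rfl hm, P.zero_mem⟩
  add_mem' := by
    rintro F G ⟨hF, hFP⟩ ⟨hG, hGP⟩
    refine ⟨fun m hm => ?_, P.add_mem hFP hGP⟩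
    by_cases h : F m = 0
    · exact hG m fun h' => hm (by rw [Finsupp.add_apply, h, h', add_zero])
    · exact hF m h
  smul_mem' := by
    rintro c F ⟨hF, hFP⟩
    refine ⟨fun m hm => hF m fun h => hm (by rw [Finsupp.smul_apply, h, smul_zero]), ?_⟩
    rw [AddMonoidAlgebra.ofCoeff_smul]
    exact Submodule.smul_of_tower_mem P c hFP

theorem IsLeadingPart.single_mul [AddCommGroup Γ] [LinearOrder Γ] [IsOrderedAddMonoid Γ]
    {χ : (ι →₀ ℕ) →+ Γ} {δ : Γ} {v y : AddMonoidAlgebra k (ι →₀ ℕ)}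
    (h : IsLeadingPart χ δ v.coeff y.coeff) (a : ι →₀ ℕ) :
    IsLeadingPart χ (χ a + δ) (AddMonoidAlgebra.single a 1 * v).coeff
      (AddMonoidAlgebra.single a 1 * y).coeff := by
  have key : ∀ m, (∃ b, m = a + b ∧ (∀ x : AddMonoidAlgebra k (ι →₀ ℕ),
      (AddMonoidAlgebra.single a 1 * x).coeff m = x.coeff b)) ∨
      ∀ x : AddMonoidAlgebra k (ι →₀ ℕ), (AddMonoidAlgebra.single a 1 * x).coeff m = 0 := by
    intro m
    by_cases hm : ∃ b, a + b = m
    · obtain ⟨b, rfl⟩ := hm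
      exact Or.inl ⟨b, rfl, fun x => by
        rw [AddMonoidAlgebra.coeff_single_mul_add, one_mul]⟩
    · push Not at hm
      exact Or.inr fun x => AddMonoidAlgebra.coeff_single_mul_of_forall_add_ne _ _ hm
  refine ⟨fun m hm => ?_, fun m hm => ?_, fun m hm => ?_⟩ <;>
    rcases key m with ⟨b, rfl, hb⟩ | h0
  · rw [hb]; exact h.1 b (by simpa using hm)
  · exact h0 _
  · rw [hb, hb]; exact h.2.1 b (by simpa using hm)
  · rw [h0, h0]
  · rw [hb]; exact h.2.2 b (by simpa using hm)
  · exact h0 _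

/-- A nonzero leading part depends only on the order that χ induces on the support of v; this lets
values move from a non-Archimedean group to ℝ. -/
theorem IsLeadingPart.of_forall_le_iff {M Γ Γ' : Type*} [LinearOrder Γ] [LinearOrder Γ']
    {χ : M → Γ} {χ' : M → Γ'} {v y : M →₀ k} {δ : Γ}
    (hχ : ∀ m, v m ≠ 0 → ∀ m', v m' ≠ 0 → (χ m ≤ χ m' ↔ χ' m ≤ χ' m'))
    (h : IsLeadingPart χ δ v y) (hy : y ≠ 0) : ∃ δ', IsLeadingPart χ' δ' v y := by
  obtain ⟨h1, h2, h3⟩ := h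
  obtain ⟨m, hm⟩ := Finsupp.ne_iff.mp hy
  obtain rfl : χ m = δ := by_contra fun hc => hm (h3 m hc)
  have hvm : v m ≠ 0 := h2 m rfl ▸ hm
  have hmin : ∀ m', v m' ≠ 0 → χ m ≤ χ m' := fun m' hm' => not_lt.mp fun hc => hm' (h1 m' hc)
  refine ⟨χ' m, fun m' hm' => ?_, fun m' hm' => ?_, fun m' hm' => ?_⟩
  · by_contra hc
    exact not_le.mpr hm' ((hχ m hvm m' hc).mp (hmin m' hc))
  · by_cases hc : v m' = 0
    · by_cases hd : χ m' = χ m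
      · exact h2 m' hd
      · rw [h3 m' hd, hc]
    · exact h2 m' (le_antisymm ((hχ m' hc m hvm).mpr hm'.le) (hmin m' hc))
  · by_cases hd : χ m' = χ m
    · rw [h2 m' hd]
      by_contra hc
      exact hm' (le_antisymm ((hχ m' hc m hvm).mp hd.le) ((hχ m hvm m' hc).mp hd.ge))
    · exact h3 m' hd

variable [Finite ι] [AddCommGroup Γ] [LinearOrder Γ] [IsOrderedAddMonoid Γ]

/-- Whether a homogeneous component of `P` contains an element with a unique `χ`-minimal term is
determined, in the direction from `χ'` to `χ`, by the comparisons on a finite set. -/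
theorem exists_finset_hasUniqueMin (P : Ideal (AddMonoidAlgebra k (ι →₀ ℕ)))
    (χ : (ι →₀ ℕ) →+ Γ) :
    ∃ S : Finset (ι →₀ ℕ), ∀ χ' : (ι →₀ ℕ) →+ ℝ,
      (∀ m ∈ S, ∀ m' ∈ S, (χ m ≤ χ m' ↔ χ' m ≤ χ' m')) →
      ∀ d, ∀ f ∈ homogeneousPart P d, HasUniqueMin χ' f →
        ∃ g ∈ homogeneousPart P d, HasUniqueMin χ g := by
  have : IsNoetherianRing (AddMonoidAlgebra k (ι →₀ ℕ)) :=
    inferInstanceAs (IsNoetherianRing (MvPolynomial ι k))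
  set E : Set (AddMonoidAlgebra k (ι →₀ ℕ)) := {y | y ≠ 0 ∧ ∃ F d δ,
    AddMonoidAlgebra.coeff F ∈ homogeneousPart P d ∧ IsLeadingPart χ δ F.coeff y.coeff} with hE
  obtain ⟨E', hE'E, hE'⟩ := (Submodule.fg_span_iff_fg_span_finset_subset E).mp
    (IsNoetherian.noetherian (Ideal.span E))
  choose hne F d δ hF hFlead using fun y : E' => hE'E y.2
  -- Agreement on these supports makes each generator y a leading part of its lift `F y` for χ' as
  -- well.
  refine ⟨Finset.univ.biUnion fun y => (F y).coeff.support, fun χ' hχ' D f hf hfm => ?_⟩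
  have hlead' : ∀ y : E', ∃ δ', IsLeadingPart χ' δ' (F y).coeff y.1.coeff :=
    fun y => (hFlead y).of_forall_le_iff (fun m hm m' hm' => hχ' m (by simpa using ⟨y, y.2, hm⟩) m'
      (by simpa using ⟨y, y.2, hm'⟩)) fun h => hne y (AddMonoidAlgebra.coeff_eq_zero.mp h)
  choose δ' hδ' using hlead'
  set G : Set ((ι →₀ ℕ) →₀ k) := {g | ∃ (y : E') (a : ι →₀ ℕ), a.degree + d y = D ∧
    g = (AddMonoidAlgebra.single a 1 * y.1).coeff} with hG
  have hmulsupp : ∀ (x : AddMonoidAlgebra k (ι →₀ ℕ)) (a : ι →₀ ℕ) (e : ℕ),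
      (∀ m, x.coeff m ≠ 0 → m.degree = e) →
      ∀ m, (AddMonoidAlgebra.single a 1 * x).coeff m ≠ 0 → m.degree = a.degree + e := by
    intro x a e hx m hm
    by_cases hb : ∃ b, a + b = m
    · obtain ⟨b, rfl⟩ := hb
      rw [AddMonoidAlgebra.coeff_single_mul_add, one_mul] at hm
      rw [map_add, hx b hm]
    · push Not at hb
      exact absurd (AddMonoidAlgebra.coeff_single_mul_of_forall_add_ne _ _ hb) hm
  have hydeg : ∀ y : E', ∀ m, y.1.coeff m ≠ 0 → m.degree = d y := by
    intro y m hm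
    refine (hF y).1 m ?_
    by_cases hd : χ m = δ y
    · rwa [← (hFlead y).2.1 m hd]
    · exact absurd ((hFlead y).2.2 m hd) hm
  obtain ⟨m, a, ha, hfm⟩ := hasUniqueMin_iff.mp hfm
  have hfin : {m : ι →₀ ℕ | m.degree ≤ D}.Finite := Finsupp.finite_of_degree_le D
  have hGlead : ∀ y ∈ G, ∃ w ∈ homogeneousPart P D, (∃ δ, IsLeadingPart χ δ w y) ∧
      ∃ δ, IsLeadingPart χ' δ w y := by
    rintro _ ⟨y, b, hb, rfl⟩
    refine ⟨(AddMonoidAlgebra.single b 1 * F y).coeff, ⟨?_, P.mul_mem_left _ (hF y).2⟩,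
      ⟨_, (hFlead y).single_mul b⟩, ⟨_, (hδ' y).single_mul b⟩⟩
    rw [← hb]
    exact hmulsupp _ b _ (hF y).1
  have hspan : ∀ v ∈ homogeneousPart P D, ∀ δ z, IsLeadingPart χ δ v z →
      z ∈ Submodule.span k G := by
    intro v hv ε z hz
    by_cases hz0 : z = 0
    · rw [hz0]; exact Submodule.zero_mem _
    have hzL : AddMonoidAlgebra.ofCoeff z ∈ Submodule.span (AddMonoidAlgebra k (ι →₀ ℕ))
        (E' : Set (AddMonoidAlgebra k (ι →₀ ℕ))) := by
      rw [← hE']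
      exact Submodule.subset_span ⟨fun h => hz0 (AddMonoidAlgebra.ofCoeff_eq_zero.mp h),
        AddMonoidAlgebra.ofCoeff v, D, ε, hv, hz⟩
    -- Projection to degree D turns ideal membership into a k-linear combination of monomial
    -- multiples of generators: a multiple of the wrong degree is killed.
    let pr : AddMonoidAlgebra k (ι →₀ ℕ) →ₗ[k] ((ι →₀ ℕ) →₀ k) :=
      { toFun := fun x => x.coeff.filter fun m => m.degree = D
        map_add' := fun x y => by simp [Finsupp.filter_add]
        map_smul' := fun c x => by simp [Finsupp.filter_smul] }
    have hall : ∀ x ∈ Submodule.span (AddMonoidAlgebra k (ι →₀ ℕ))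
        (E' : Set (AddMonoidAlgebra k (ι →₀ ℕ))), pr x ∈ Submodule.span k G := by
      have hgen : ∀ y : E', ∀ r : AddMonoidAlgebra k (ι →₀ ℕ),
          pr (r * y.1) ∈ Submodule.span k G := by
        intro y r
        induction r using AddMonoidAlgebra.induction_linear with
        | zero => rw [zero_mul, map_zero]; exact Submodule.zero_mem _
        | add r s hr hs => rw [add_mul, map_add]; exact Submodule.add_mem _ hr hs
        | single b c =>
          have h1 : AddMonoidAlgebra.single b c * y.1 =
              c • (AddMonoidAlgebra.single b 1 * y.1) := by
            rw [← smul_mul_assoc, AddMonoidAlgebra.smul_single, smul_eq_mul, mul_one]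
          rw [h1, map_smul]
          refine Submodule.smul_mem _ _ ?_
          have hdeg := hmulsupp y.1 b _ (hydeg y)
          by_cases hb : b.degree + d y = D
          · refine Submodule.subset_span ⟨y, b, hb, ?_⟩
            exact (Finsupp.filter_eq_self_iff _ _).mpr fun m hm => (hdeg m hm).trans hb
          · have : pr (AddMonoidAlgebra.single b 1 * y.1) = 0 :=
              (Finsupp.filter_eq_zero_iff _ _).mpr fun m hm => by
                by_contra hc
                exact hb ((hdeg m hc).symm.trans hm)
            rw [this]; exact Submodule.zero_mem _
      intro x hx
      rw [Submodule.mem_span_finset] at hx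
      obtain ⟨c, -, rfl⟩ := hx
      rw [map_sum]
      exact Submodule.sum_mem _ fun y hy => hgen ⟨y, hy⟩ (c y)
    have : pr (AddMonoidAlgebra.ofCoeff z) = z :=
      (Finsupp.filter_eq_self_iff _ _).mpr fun m hm => hv.1 m <| by
        by_cases hd : χ m = ε
        · rwa [← hz.2.1 m hd]
        · exact absurd (hz.2.2 m hd) hm
    exact this ▸ hall _ hzL
  obtain ⟨g, hg, hgl⟩ := exists_isLeadingPart_single (χ := χ) (χ' := χ') (T := hfin.toFinset)
    (V := homogeneousPart P D) (G := G) (fun v hv m hm => by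
      simpa using (hv.1 m (Finsupp.mem_support_iff.mp hm)).le) hGlead hspan hf ha hfm
  exact ⟨g, hg, hasUniqueMin_iff.mpr ⟨m, a, ha, hgl⟩⟩

end Homogeneous

/-! ### Finite test supports for all characters, by ultraproducts. -/

section FiniteBasis

open Filter

variable {H : Type*} [AddCommGroup H]

/-- The extra variable `none` maps to 0 and serves for homogenization: it absorbs any missing
degree. -/
theorem exists_graded_epimorphism (H : Type*) [AddCommGroup H] [AddGroup.FG H] :
    ∃ (n : ℕ) (σ : (Option (Fin n) →₀ ℕ) →+ H),
      ∀ h, ∃ D, ∀ d, D ≤ d → ∃ m, m.degree = d ∧ σ m = h := by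
  obtain ⟨n, f, hf⟩ := AddSubmonoid.fg_iff_exists_fin_addMonoidHom.mp
    (AddMonoid.fg_def.mp (AddGroup.fg_iff_addMonoid_fg.mp ‹AddGroup.FG H›))
  let r : (Option (Fin n) →₀ ℕ) →+ (Fin n → ℕ) :=
    { toFun := fun m i => m (some i), map_zero' := rfl, map_add' := fun _ _ => rfl }
  refine ⟨n, f.comp r, fun h => ?_⟩
  obtain ⟨g, rfl⟩ : h ∈ AddMonoidHom.mrange f := hf ▸ AddSubmonoid.mem_top h
  refine ⟨∑ i, g i, fun d hd =>
    ⟨Finsupp.equivFunOnFinite.symm fun o => o.elim (d - ∑ i, g i) g, ?_, ?_⟩⟩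
  · rw [Finsupp.degree_eq_sum, Fintype.sum_option]
    exact Nat.sub_add_cancel hd
  · rfl

/-- Over a field, the existence of an element of `J` with a unique `χ`-minimal term can be tested,
for all `χ` simultaneously, on elements with support in a fixed finite set. -/
theorem exists_finset_support_hasUniqueMin [AddGroup.FG H] {k : Type*} [Field k]
    (J : Ideal (AddMonoidAlgebra k H)) :
    ∃ T : Finset H, ∀ χ : H →+ ℝ, (∃ f ∈ J, HasUniqueMin χ f.coeff) →
      ∃ f ∈ J, f.coeff.support ⊆ T ∧ HasUniqueMin χ f.coeff := by
  by_contra hcon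
  push Not at hcon
  choose X hX hX' using hcon
  -- Being finer than `atTop`, φ makes almost every T contain a given finite support. Hence a unique
  -- minimum for the limit character would contradict the choice of some `X T`.
  let φ : Ultrafilter (Finset H) := Ultrafilter.of atTop
  have hφ : (φ : Filter (Finset H)) ≤ atTop := Ultrafilter.of_le _
  let χ : H →+ Germ (φ : Filter (Finset H)) ℝ :=
    { toFun := fun h => ((fun T => X T h : Finset H → ℝ) : Germ (φ : Filter (Finset H)) ℝ)
      map_zero' := by simp only [map_zero]; rfl
      map_add' := fun a b => by simp only [map_add]; rfl }
  have hχlt : ∀ a b, χ a < χ b ↔ ∀ᶠ T in φ, X T a < X T b := fun a b => Germ.coe_lt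
  have hχle : ∀ a b, χ a ≤ χ b ↔ ∀ᶠ T in φ, X T a ≤ X T b := fun a b => Germ.coe_le
  have hnot : ∀ f ∈ J, ¬ HasUniqueMin χ f.coeff := by
    rintro f hf ⟨m, hm, hmin⟩
    have h1 : ∀ᶠ T in (φ : Filter (Finset H)), ∀ m' ∈ f.coeff.support, m' ≠ m →
        X T m < X T m' := by
      rw [Finset.eventually_all]
      intro m' hm'
      by_cases he : m' = m
      · exact Eventually.of_forall fun T h => absurd he h
      · exact ((hχlt _ _).mp (hmin m' (Finsupp.mem_support_iff.mp hm') he)).mono fun T h _ => h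
    have h2 : ∀ᶠ T in (φ : Filter (Finset H)), f.coeff.support ≤ T :=
      hφ (eventually_ge_atTop f.coeff.support)
    obtain ⟨T, hT1, hT2⟩ := (h1.and h2).exists
    exact hX' T f hf hT2 ⟨m, hm, fun m' hm' => hT1 m' (Finsupp.mem_support_iff.mpr hm')⟩
  obtain ⟨n, σ, hσ⟩ := exists_graded_epimorphism H
  set P := J.comap (AddMonoidAlgebra.mapDomainRingHom k σ) with hP
  obtain ⟨S, hS⟩ := exists_finset_hasUniqueMin P (χ.comp σ)
  have hagree : ∀ᶠ T in (φ : Filter (Finset H)), ∀ m ∈ S, ∀ m' ∈ S,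
      (χ.comp σ m ≤ χ.comp σ m' ↔ (X T).comp σ m ≤ (X T).comp σ m') := by
    rw [Finset.eventually_all]
    intro m _
    rw [Finset.eventually_all]
    intro m' _
    by_cases hle : χ (σ m) ≤ χ (σ m')
    · exact ((hχle _ _).mp hle).mono fun T h => ⟨fun _ => h, fun _ => hle⟩
    · exact ((hχlt _ _).mp (not_le.mp hle)).mono fun T h =>
        ⟨fun h' => absurd h' hle, fun h' => absurd h' (not_le.mpr h)⟩
  obtain ⟨T, hT⟩ := hagree.exists
  obtain ⟨f, hf, hfm⟩ := hX T
  choose D hD using hσ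
  -- All support points are lifted to one common degree, so the lift of f is homogeneous.
  have hlift : ∀ h, ∃ m, σ m = h ∧ (h ∈ f.coeff.support → m.degree = f.coeff.support.sup D) := by
    intro h
    by_cases hh : h ∈ f.coeff.support
    · obtain ⟨m, hm, hm'⟩ := hD h _ (Finset.le_sup hh)
      exact ⟨m, hm', fun _ => hm⟩
    · obtain ⟨m, -, hm'⟩ := hD h _ le_rfl
      exact ⟨m, hm', fun h' => absurd h' hh⟩
  choose t ht htd using hlift
  have hF : f.coeff.mapDomain t ∈ homogeneousPart P (f.coeff.support.sup D) := by
    constructor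
    · intro m hm
      obtain ⟨h, hh, rfl⟩ := Finset.mem_image.mp
        (Finsupp.mapDomain_support (Finsupp.mem_support_iff.mpr hm))
      exact htd h hh
    · rw [hP, Ideal.mem_comap]
      convert hf
      apply AddMonoidAlgebra.coeff_injective
      change Finsupp.mapDomain σ (Finsupp.mapDomain t f.coeff) = f.coeff
      rw [← Finsupp.mapDomain_comp, show ⇑σ ∘ t = id from funext ht, Finsupp.mapDomain_id]
  obtain ⟨g, hg, hgm⟩ := hS ((X T).comp σ) hT _ _ hF
    (HasUniqueMin.mapDomain (by simpa [ht] using hfm))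
  exact hnot _ hg.2 (HasUniqueMin.mapDomain hgm)

end FiniteBasis

/-! ### Initial ideals -/

section InitialIdeal

variable {R : Type*} [CommRing R] {H : Type*} [AddCommGroup H]

/-- `f` is the sum of `1` and of terms of positive `χ`-degree. -/
def IsOneAddPos (χ : H →+ ℝ) (f : AddMonoidAlgebra R H) : Prop :=
  f.coeff 0 = 1 ∧ ∀ h, f.coeff h ≠ 0 → h ≠ 0 → 0 < χ h

/-- The initial ideal is graded by χ-degree, and each graded slice is the degree-c slice of an
element of I with no lower terms. Allowing the slice to vanish makes the property additive; a
monomial factor only shifts c. -/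
theorem exists_coeff_eq_of_mem_initialIdeal {χ : H →+ ℝ} {I : Ideal (AddMonoidAlgebra R H)}
    {y : AddMonoidAlgebra R H} (hy : y ∈ initialIdeal χ I) (c : ℝ) :
    ∃ f ∈ I, (∀ h, χ h < c → f.coeff h = 0) ∧ ∀ h, χ h = c → f.coeff h = y.coeff h := by
  induction hy using Submodule.span_induction generalizing c with
  | zero => exact ⟨0, I.zero_mem, fun _ _ => rfl, fun _ _ => rfl⟩
  | add y z _ _ hy hz =>
    obtain ⟨f, hf, hf1, hf2⟩ := hy c
    obtain ⟨g, hg, hg1, hg2⟩ := hz c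
    refine ⟨f + g, I.add_mem hf hg, fun h hh => ?_, fun h hh => ?_⟩
    · rw [AddMonoidAlgebra.coeff_add, Finsupp.add_apply, hf1 h hh, hg1 h hh, add_zero]
    · rw [AddMonoidAlgebra.coeff_add, AddMonoidAlgebra.coeff_add, Finsupp.add_apply,
        Finsupp.add_apply, hf2 h hh, hg2 h hh]
  | smul a y _ hy =>
    induction a using AddMonoidAlgebra.induction_linear with
    | zero => exact ⟨0, I.zero_mem, fun _ _ => rfl, fun _ _ => by rw [zero_smul]⟩
    | add a b ha hb =>
      obtain ⟨f, hf, hf1, hf2⟩ := ha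
      obtain ⟨g, hg, hg1, hg2⟩ := hb
      refine ⟨f + g, I.add_mem hf hg, fun h hh => ?_, fun h hh => ?_⟩
      · rw [AddMonoidAlgebra.coeff_add, Finsupp.add_apply, hf1 h hh, hg1 h hh, add_zero]
      · rw [add_smul, AddMonoidAlgebra.coeff_add, AddMonoidAlgebra.coeff_add, Finsupp.add_apply,
          Finsupp.add_apply, hf2 h hh, hg2 h hh]
    | single g r =>
      obtain ⟨f, hf, hf1, hf2⟩ := hy (c - χ g)
      refine ⟨AddMonoidAlgebra.single g r * f, I.mul_mem_left _ hf, fun h hh => ?_, fun h hh => ?_⟩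
      · rw [AddMonoidAlgebra.coeff_single_mul_apply, hf1, mul_zero]
        rw [map_add, map_neg]; linarith
      · rw [smul_eq_mul, AddMonoidAlgebra.coeff_single_mul_apply,
          AddMonoidAlgebra.coeff_single_mul_apply, hf2]
        rw [map_add, map_neg]; linarith
  | mem y hy =>
    obtain ⟨f, hf, rfl⟩ := hy
    have hin : ∀ h, (initialForm χ f).coeff h =
        if ∀ g ∈ f.coeff.support, χ h ≤ χ g then f.coeff h else 0 := fun h => rfl
    by_cases hc : ∃ h, f.coeff h ≠ 0 ∧ χ h ≤ c
    · by_cases hc' : ∃ h, f.coeff h ≠ 0 ∧ χ h < c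
      · obtain ⟨g, hg, hgc⟩ := hc'
        refine ⟨0, I.zero_mem, fun _ _ => rfl, fun h hh => ?_⟩
        rw [hin, if_neg]
        · rfl
        · exact fun H => not_le.mpr (hgc.trans_eq hh.symm) (H g (Finsupp.mem_support_iff.mpr hg))
      · push Not at hc'
        refine ⟨f, hf, fun h hh => ?_, fun h hh => ?_⟩
        · by_contra h0
          exact not_le.mpr hh (hc' h h0)
        · rw [hin, if_pos]
          exact fun g hg => hh.trans_le (hc' g (Finsupp.mem_support_iff.mp hg))
    · push Not at hc
      have h0 : ∀ h, χ h = c → f.coeff h = 0 := fun h hh => by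
        by_contra hne
        exact (hc h hne).ne' hh
      refine ⟨0, I.zero_mem, fun _ _ => rfl, fun h hh => ?_⟩
      rw [hin, h0 h hh, ite_self]
      rfl

/-- If 1 is in the initial ideal, its degree-0 slice lifts to an element of I; conversely the
initial form of 1 + (positive terms) is 1. -/
theorem notMem_tropRing_iff [Nontrivial R] {χ : H →+ ℝ} {I : Ideal (AddMonoidAlgebra R H)} :
    χ ∉ tropRing I ↔ ∃ f ∈ I, IsOneAddPos χ f := by
  rw [tropRing, Set.mem_ofPred_eq, not_not]
  constructor
  · intro h
    obtain ⟨f, hf, hf1, hf2⟩ :=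
      exists_coeff_eq_of_mem_initialIdeal (h ▸ Submodule.mem_top : (1 : _) ∈ initialIdeal χ I) 0
    refine ⟨f, hf, ?_, fun h hne h0 => ?_⟩
    · rw [hf2 0 (map_zero χ), AddMonoidAlgebra.one_def, AddMonoidAlgebra.coeff_single,
        Finsupp.single_eq_same]
    · refine lt_of_not_ge fun hle => hne ?_
      rcases hle.lt_or_eq with hlt | heq
      · exact hf1 h hlt
      · rw [hf2 h heq, AddMonoidAlgebra.one_def, AddMonoidAlgebra.coeff_single,
          Finsupp.single_eq_of_ne h0]
  · rintro ⟨f, hf, hf0, hpos⟩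
    rw [Ideal.eq_top_iff_one]
    refine Submodule.subset_span ⟨f, hf, ?_⟩
    apply AddMonoidAlgebra.coeff_injective
    ext h
    change (if ∀ g ∈ f.coeff.support, χ h ≤ χ g then f.coeff h else 0) = Finsupp.single 0 1 h
    by_cases h0 : h = 0
    · rw [h0, Finsupp.single_eq_same, if_pos, hf0]
      intro g hg
      by_cases hg0 : g = 0
      · rw [hg0]
      · rw [map_zero]
        exact (hpos g (Finsupp.mem_support_iff.mp hg) hg0).le
    · rw [Finsupp.single_eq_of_ne h0]
      split_ifs with hc
      · by_contra hne
        have := hc 0 (Finsupp.mem_support_iff.mpr (by rw [hf0]; exact one_ne_zero))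
        exact not_le.mpr (hpos h hne h0) (by rwa [map_zero] at this)
      · rfl

end InitialIdeal

/-! ### Membership in tropical varieties over valued fields -/

section TropField

variable {H : Type*} [AddCommGroup H]

theorem mem_extendIdeal_of_mem (k : Type*) [Field k] {I : Ideal (AddMonoidAlgebra ℤ H)}
    {F : AddMonoidAlgebra ℤ H} (hF : F ∈ I) :
    ∃ f ∈ extendIdeal k I, ∀ h, f.coeff h = (F.coeff h : k) :=
  ⟨_, Ideal.mem_map_of_mem _ hF, fun _ => rfl⟩

/-- Clearing denominators. -/
theorem exists_mem_of_mem_extendIdeal_rat {I : Ideal (AddMonoidAlgebra ℤ H)}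
    {f : AddMonoidAlgebra ℚ H} (hf : f ∈ extendIdeal ℚ I) :
    ∃ n : ℤ, n ≠ 0 ∧ ∃ F ∈ I, ∀ h, (F.coeff h : ℚ) = n * f.coeff h := by
  induction hf using Submodule.span_induction with
  | zero => exact ⟨1, one_ne_zero, 0, I.zero_mem, fun h => by simp⟩
  | mem x hx =>
    obtain ⟨F, hF, rfl⟩ := hx
    exact ⟨1, one_ne_zero, F, hF, fun h => by simp⟩
  | add x y _ _ hx hy =>
    obtain ⟨n, hn, F, hF, hFx⟩ := hx
    obtain ⟨m, hm, G, hG, hGy⟩ := hy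
    refine ⟨n * m, mul_ne_zero hn hm, m • F + n • G,
      I.add_mem (Submodule.smul_of_tower_mem I m hF) (Submodule.smul_of_tower_mem I n hG),
      fun h => ?_⟩
    simp only [AddMonoidAlgebra.coeff_add, AddMonoidAlgebra.coeff_smul, Finsupp.add_apply,
      Finsupp.smul_apply, smul_eq_mul]
    push_cast
    rw [hFx, hGy]
    ring
  | smul a x _ hx =>
    induction a using AddMonoidAlgebra.induction_linear with
    | zero => exact ⟨1, one_ne_zero, 0, I.zero_mem, fun h => by simp⟩
    | add a b ha hb =>
      obtain ⟨n, hn, F, hF, hFx⟩ := ha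
      obtain ⟨m, hm, G, hG, hGy⟩ := hb
      refine ⟨n * m, mul_ne_zero hn hm, m • F + n • G,
        I.add_mem (Submodule.smul_of_tower_mem I m hF) (Submodule.smul_of_tower_mem I n hG),
        fun h => ?_⟩
      simp only [AddMonoidAlgebra.coeff_add, AddMonoidAlgebra.coeff_smul, add_mul,
        Finsupp.add_apply, Finsupp.smul_apply, smul_eq_mul] at hFx hGy ⊢
      push_cast
      rw [hFx, hGy]
      ring
    | single g r =>
      obtain ⟨n, hn, F, hF, hFx⟩ := hx
      refine ⟨r.den * n, mul_ne_zero (by exact_mod_cast r.den_nz) hn,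
        AddMonoidAlgebra.single g r.num * F, I.mul_mem_left _ hF, fun h => ?_⟩
      rw [smul_eq_mul, AddMonoidAlgebra.coeff_single_mul_apply,
        AddMonoidAlgebra.coeff_single_mul_apply]
      push_cast
      rw [hFx]
      linear_combination -(n * x.coeff (-g + h)) * Rat.mul_den_eq_num r

variable [AddGroup.FG H]

theorem notMem_tropField_iff {k : Type*} [Field k] {v : AddValuation k (WithTop ℝ)}
    {J : Ideal (AddMonoidAlgebra k H)} {χ : H →+ ℝ} :
    χ ∉ tropField v J ↔ ∃ f ∈ J, ∃ u, f.coeff u ≠ 0 ∧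
      ∀ u', f.coeff u' ≠ 0 → u' ≠ u → tropTerm v f χ u < tropTerm v f χ u' := by
  obtain ⟨n, ψ, hψ⟩ := AddSubgroup.fg_iff_exists_fin_addMonoidHom.mp
    (AddGroup.fg_def.mp ‹AddGroup.FG H›)
  rw [tropField_eq v ψ (AddMonoidHom.range_eq_top.mp hψ), Set.mem_ofPred_eq,
    comp_mem_tropLaurent_iff v ψ (AddMonoidHom.range_eq_top.mp hψ)]
  push Not
  constructor
  · rintro ⟨f, hf, hf0, hχ⟩
    have hne : f.coeff.support.Nonempty :=
      Finsupp.support_nonempty_iff.mpr fun h => hf0 (AddMonoidAlgebra.coeff_eq_zero.mp h)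
    obtain ⟨u, hu, hmin⟩ := Finset.exists_mem_eq_inf f.coeff.support hne (tropTerm v f χ)
    refine ⟨f, hf, u, Finsupp.mem_support_iff.mp hu, fun u' hu' hne' => ?_⟩
    have hu'' := Finsupp.mem_support_iff.mpr hu'
    refine lt_of_le_of_ne (hmin ▸ Finset.inf_le hu'') fun he => hχ ?_
    exact ⟨u, hu, u', hu'', hne'.symm, hmin.symm, (he ▸ hmin).symm⟩
  · rintro ⟨f, hf, u, hu, hlt⟩
    refine ⟨f, hf, fun h0 => hu (by rw [h0]; rfl), ?_⟩
    rintro ⟨a, ha, b, hb, hab, h1, h2⟩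
    have key : ∀ a ∈ f.coeff.support, tropTerm v f χ a = tropPoly v f χ → a = u := by
      intro a ha h1
      by_contra hau
      refine not_le.mpr (hlt a (Finsupp.mem_support_iff.mp ha) hau) (h1.trans_le ?_)
      exact Finset.inf_le (Finsupp.mem_support_iff.mpr hu)
    exact hab ((key a ha h1).trans (key b hb h2).symm)

theorem tropTerm_trivialVal {G k : Type*} [AddCommGroup G] [Field k] (f : AddMonoidAlgebra k G)
    (w : G →+ ℝ) {u : G} (hu : f.coeff u ≠ 0) :
    tropTerm (trivialVal k) f w u = ((w u : ℝ) : WithTop ℝ) := by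
  have : trivialVal k (f.coeff u) = 0 := if_neg hu
  rw [tropTerm, this, zero_add]

theorem tropTerm_padicVal {G : Type*} [AddCommGroup G] (p : Nat.Primes) (f : AddMonoidAlgebra ℚ G)
    (w : G →+ ℝ) {u : G} (hu : f.coeff u ≠ 0) :
    tropTerm (padicVal p) f w u =
      ((((padicValRat p (f.coeff u) : ℤ) : ℝ) + w u : ℝ) : WithTop ℝ) := by
  have : padicVal p (f.coeff u) = ((padicValRat p (f.coeff u) : ℤ) : ℝ) := if_neg hu
  rw [tropTerm, this]
  rfl

theorem notMem_tropField_trivialVal_iff {k : Type*} [Field k]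
    {J : Ideal (AddMonoidAlgebra k H)} {χ : H →+ ℝ} :
    χ ∉ tropField (trivialVal k) J ↔ ∃ f ∈ J, HasUniqueMin χ f.coeff := by
  rw [notMem_tropField_iff]
  refine exists_congr fun f => and_congr_right fun _ => exists_congr fun u =>
    and_congr_right fun hu => forall_congr' fun u' => forall_congr' fun hu' => ?_
  rw [tropTerm_trivialVal f χ hu, tropTerm_trivialVal f χ hu', WithTop.coe_lt_coe]

theorem notMem_tropField_padicVal_iff {p : Nat.Primes}
    {J : Ideal (AddMonoidAlgebra ℚ H)} {χ : H →+ ℝ} :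
    χ ∉ tropField (padicVal p) J ↔ ∃ f ∈ J, ∃ u, f.coeff u ≠ 0 ∧
      ∀ u', f.coeff u' ≠ 0 → u' ≠ u →
        (padicValRat p (f.coeff u) : ℝ) + χ u < padicValRat p (f.coeff u') + χ u' := by
  rw [notMem_tropField_iff]
  refine exists_congr fun f => and_congr_right fun _ => exists_congr fun u =>
    and_congr_right fun hu => forall_congr' fun u' => forall_congr' fun hu' => ?_
  rw [tropTerm_padicVal p f χ hu, tropTerm_padicVal p f χ hu', WithTop.coe_lt_coe]

theorem notMem_tropField_trivialVal_extendIdeal_rat_iff {I : Ideal (AddMonoidAlgebra ℤ H)}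
    {χ : H →+ ℝ} :
    χ ∉ tropField (trivialVal ℚ) (extendIdeal ℚ I) ↔ ∃ F ∈ I, HasUniqueMin χ F.coeff := by
  rw [notMem_tropField_trivialVal_iff]
  constructor
  · rintro ⟨f, hf, u, hu, hlt⟩
    obtain ⟨n, hn, F, hF, hFf⟩ := exists_mem_of_mem_extendIdeal_rat hf
    have hne : ∀ h, F.coeff h ≠ 0 ↔ f.coeff h ≠ 0 := fun h => by
      rw [← Int.cast_ne_zero (α := ℚ), hFf]; simp [hn]
    exact ⟨F, hF, u, (hne u).mpr hu, fun u' hu' => hlt u' ((hne u').mp hu')⟩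
  · rintro ⟨F, hF, u, hu, hlt⟩
    obtain ⟨f, hf, hfF⟩ := mem_extendIdeal_of_mem ℚ hF
    exact ⟨f, hf, u, by simpa [hfF] using hu, fun u' hu' => hlt u' (by simpa [hfF] using hu')⟩

/-- Clearing denominators shifts all p-adic values of coefficients by the same constant, so the
minimum stays at the same place. -/
theorem notMem_tropField_padicVal_extendIdeal_rat_iff {I : Ideal (AddMonoidAlgebra ℤ H)}
    {p : Nat.Primes} {χ : H →+ ℝ} :
    χ ∉ tropField (padicVal p) (extendIdeal ℚ I) ↔ ∃ F ∈ I, ∃ u, F.coeff u ≠ 0 ∧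
      ∀ u', F.coeff u' ≠ 0 → u' ≠ u →
        (padicValInt p (F.coeff u) : ℝ) + χ u < padicValInt p (F.coeff u') + χ u' := by
  rw [notMem_tropField_padicVal_iff]
  constructor
  · rintro ⟨f, hf, u, hu, hlt⟩
    obtain ⟨n, hn, F, hF, hFf⟩ := exists_mem_of_mem_extendIdeal_rat hf
    have hne : ∀ h, F.coeff h ≠ 0 ↔ f.coeff h ≠ 0 := fun h => by
      rw [← Int.cast_ne_zero (α := ℚ), hFf]; simp [hn]
    have hval : ∀ h, f.coeff h ≠ 0 → (padicValInt p (F.coeff h) : ℝ) =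
        padicValRat p (n : ℚ) + padicValRat p (f.coeff h) := fun h hh => by
      have := padicValRat.mul (p := p) (q := (n : ℚ)) (by exact_mod_cast hn) hh
      rw [← hFf, padicValRat.of_int] at this
      exact_mod_cast this
    refine ⟨F, hF, u, (hne u).mpr hu, fun u' hu' hne' => ?_⟩
    have hu'' := (hne u').mp hu'
    have := hlt u' hu'' hne'
    rw [hval u hu, hval u' hu'']
    linarith
  · rintro ⟨F, hF, u, hu, hlt⟩
    obtain ⟨f, hf, hfF⟩ := mem_extendIdeal_of_mem ℚ hF
    refine ⟨f, hf, u, by simpa [hfF] using hu, fun u' hu' hne => ?_⟩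
    have := hlt u' (by simpa [hfF] using hu') hne
    rw [hfF, hfF, padicValRat.of_int, padicValRat.of_int]
    exact_mod_cast this

theorem notMem_tropField_extendIdeal_zmod_iff {I : Ideal (AddMonoidAlgebra ℤ H)}
    {p : Nat.Primes} {χ : H →+ ℝ} :
    χ ∉ tropField (trivialVal (ZMod p)) (extendIdeal (ZMod p) I) ↔
      ∃ F ∈ I, ∃ u, ¬ ((p : ℕ) : ℤ) ∣ F.coeff u ∧
        ∀ u', ¬ ((p : ℕ) : ℤ) ∣ F.coeff u' → u' ≠ u → χ u < χ u' := by
  rw [notMem_tropField_trivialVal_iff]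
  have hiff : ∀ a : ℤ, ((a : ℤ) : ZMod p) ≠ 0 ↔ ¬ ((p : ℕ) : ℤ) ∣ a := fun a =>
    not_congr (ZMod.intCast_zmod_eq_zero_iff_dvd a p)
  have hsurj : Function.Surjective
      (AddMonoidAlgebra.mapRingHom H (Int.castRingHom (ZMod p))) := by
    intro x
    induction x using AddMonoidAlgebra.induction_linear with
    | zero => exact ⟨0, map_zero _⟩
    | add x y hx hy =>
      obtain ⟨a, rfl⟩ := hx
      obtain ⟨b, rfl⟩ := hy
      exact ⟨a + b, map_add _ _ _⟩
    | single h r =>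
      obtain ⟨n, rfl⟩ := ZMod.intCast_surjective r
      exact ⟨AddMonoidAlgebra.single h n, by simp⟩
  constructor
  · rintro ⟨f, hf, u, hu, hlt⟩
    obtain ⟨F, hF, rfl⟩ := (Ideal.mem_map_iff_of_surjective _ hsurj).mp hf
    exact ⟨F, hF, u, (hiff _).mp hu, fun u' hu' => hlt u' ((hiff _).mpr hu')⟩
  · rintro ⟨F, hF, u, hu, hlt⟩
    obtain ⟨f, hf, hfF⟩ := mem_extendIdeal_of_mem (ZMod p) hF
    refine ⟨f, hf, u, ?_, fun u' hu' => hlt u' ?_⟩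
    · rw [hfF]; exact (hiff _).mpr hu
    · rw [hfF] at hu'; exact (hiff _).mp hu'

theorem tropUnion_subset_tropRing (I : Ideal (AddMonoidAlgebra ℤ H)) (P : Set Nat.Primes) :
    tropUnion I P ⊆ tropRing I := by
  intro χ hχ
  by_contra hcon
  obtain ⟨f, hf, hf0, hpos⟩ := notMem_tropRing_iff.mp hcon
  have hne : f.coeff 0 ≠ 0 := by rw [hf0]; exact one_ne_zero
  have hlt : ∀ u, f.coeff u ≠ 0 → u ≠ 0 → χ 0 < χ u := fun u hu hu0 => by
    rw [map_zero]; exact hpos u hu hu0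
  rcases hχ with h | h
  · exact notMem_tropField_trivialVal_extendIdeal_rat_iff.mpr ⟨f, hf, 0, hne, hlt⟩ h
  · obtain ⟨p, -, h | h⟩ := Set.mem_iUnion₂.mp h
    · refine notMem_tropField_padicVal_extendIdeal_rat_iff.mpr
        ⟨f, hf, 0, hne, fun u hu hu0 => ?_⟩ h
      rw [hf0, padicValInt.one, Nat.cast_zero, zero_add]
      exact (hlt u hu hu0).trans_le (le_add_of_nonneg_left (Nat.cast_nonneg _))
    · refine notMem_tropField_extendIdeal_zmod_iff.mpr ⟨f, hf, 0, ?_, fun u hu hu0 => ?_⟩ h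
      · rw [hf0]
        exact fun h => p.2.one_lt.ne' (by simpa using Int.natAbs_dvd_natAbs.mpr h)
      · exact hlt u (fun h => hu (h ▸ dvd_zero _)) hu0

/-- All but finitely many primes contribute nothing new to the union of tropical varieties. -/
theorem exists_finite_tropUnion_eq (I : Ideal (AddMonoidAlgebra ℤ H)) :
    ∃ P : Set Nat.Primes, P.Finite ∧ tropUnion I Set.univ = tropUnion I P := by
  obtain ⟨T, hT⟩ := exists_finset_support_hasUniqueMin (extendIdeal ℚ I)
  -- If χ has its only minimum on S at m, any element supported in S with nonzero coefficient at m
  -- is a witness. So one F per pair (S, m) serves all such χ.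
  have hex : ∀ (S : Finset H) (m : H), ∃ F ∈ I, F.coeff.support ⊆ S ∧
      ((∃ G ∈ I, G.coeff.support ⊆ S ∧ G.coeff m ≠ 0) → F.coeff m ≠ 0) := by
    intro S m
    by_cases h : ∃ G ∈ I, G.coeff.support ⊆ S ∧ G.coeff m ≠ 0
    · obtain ⟨G, hG, hGS, hGm⟩ := h
      exact ⟨G, hG, hGS, fun _ => hGm⟩
    · exact ⟨0, I.zero_mem, by simp, fun h' => absurd h' h⟩
  choose F hF hFS hFm using hex
  refine ⟨⋃ S ∈ T.powerset, ⋃ m ∈ T, {p | (F S m).coeff m ≠ 0 ∧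
    ((p : ℕ) : ℤ) ∣ (F S m).coeff m}, ?_, ?_⟩
  · refine Set.Finite.biUnion (Finset.finite_toSet _) fun S _ =>
      Set.Finite.biUnion (Finset.finite_toSet _) fun m _ => ?_
    by_cases h0 : (F S m).coeff m = 0
    · convert Set.finite_empty
      exact Set.eq_empty_of_forall_notMem fun p hp => hp.1 h0
    · refine Set.Finite.of_finite_image (f := fun p : Nat.Primes => (p : ℕ)) ?_
        Subtype.val_injective.injOn
      refine (Nat.divisors ((F S m).coeff m).natAbs).finite_toSet.subset ?_
      rintro _ ⟨p, ⟨-, hp⟩, rfl⟩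
      rw [Finset.mem_coe, Nat.mem_divisors]
      exact ⟨by simpa using Int.natAbs_dvd_natAbs.mpr hp, Int.natAbs_ne_zero.mpr h0⟩
  · refine subset_antisymm (fun χ hχ => ?_) ?_
    · by_contra hcon
      have h0 : χ ∉ tropField (trivialVal ℚ) (extendIdeal ℚ I) := fun h => hcon (Or.inl h)
      have hpr := hχ.resolve_left h0
      obtain ⟨p, -, hp⟩ := Set.mem_iUnion₂.mp hpr
      obtain ⟨f, hf, hfT, m, hm, hmin⟩ := hT χ (notMem_tropField_trivialVal_iff.mp h0)
      obtain ⟨n, hn, G, hG, hGf⟩ := exists_mem_of_mem_extendIdeal_rat hf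
      have hne : ∀ h, G.coeff h ≠ 0 ↔ f.coeff h ≠ 0 := fun h => by
        rw [← Int.cast_ne_zero (α := ℚ), hGf]; simp [hn]
      set S := f.coeff.support with hS
      have hc : (F S m).coeff m ≠ 0 := hFm S m ⟨G, hG, fun h hh => Finsupp.mem_support_iff.mpr
        ((hne h).mp (Finsupp.mem_support_iff.mp hh)), (hne m).mpr hm⟩
      have hlt : ∀ u, (F S m).coeff u ≠ 0 → u ≠ m → χ m < χ u := fun u hu hum =>
        hmin u (Finsupp.mem_support_iff.mp (hFS S m (Finsupp.mem_support_iff.mpr hu))) hum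
      -- For a prime outside the chosen set the coefficient at m is a p-adic unit, so the witness
      -- over trivially valued ℚ also works for v_p and over 𝔽_p.
      have hndvd : ¬ ((p : ℕ) : ℤ) ∣ (F S m).coeff m := by
        intro hdvd
        refine hcon (Or.inr (Set.mem_iUnion₂.mpr ⟨p, ?_, hp⟩))
        simp only [Set.mem_iUnion]
        exact ⟨S, Finset.mem_powerset.mpr hfT, m, hfT (Finsupp.mem_support_iff.mpr hm), hc, hdvd⟩
      rcases hp with hp | hp
      · refine notMem_tropField_padicVal_extendIdeal_rat_iff.mpr
          ⟨_, hF S m, m, hc, fun u hu hum => ?_⟩ hp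
        rw [padicValInt.eq_zero_of_not_dvd hndvd, Nat.cast_zero, zero_add]
        exact (hlt u hu hum).trans_le (le_add_of_nonneg_left (Nat.cast_nonneg _))
      · exact notMem_tropField_extendIdeal_zmod_iff.mpr ⟨_, hF S m, m, hndvd,
          fun u hu hum => hlt u (fun h => hu (h ▸ dvd_zero _)) hum⟩ hp
    · exact Set.union_subset_union_right _
        (Set.biUnion_subset_biUnion_left (Set.subset_univ _))

end TropField

/-! ### Characters induced by valuations -/

section Valuation

variable {H : Type*} [AddCommGroup H]

/-- The additive subgroup of the elements all of whose terms have positive `χ`-degree. -/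
def posPart (R : Type*) [CommRing R] (χ : H →+ ℝ) : AddSubgroup (AddMonoidAlgebra R H) where
  carrier := {f | ∀ h, f.coeff h ≠ 0 → 0 < χ h}
  zero_mem' := fun h hh => absurd rfl hh
  add_mem' := by
    intro f g hf hg h hh
    by_cases h0 : f.coeff h = 0
    · exact hg h fun h1 => hh (by rw [AddMonoidAlgebra.coeff_add, Finsupp.add_apply, h0, h1,
        add_zero])
    · exact hf h h0
  neg_mem' := by
    intro f hf h hh
    exact hf h fun h0 => hh (by rw [AddMonoidAlgebra.coeff_neg, Finsupp.neg_apply, h0, neg_zero])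

theorem exists_coeff_ne_zero_of_mul {R : Type*} [CommRing R] {f g : AddMonoidAlgebra R H} {h : H}
    (hh : (f * g).coeff h ≠ 0) :
    ∃ a b, f.coeff a ≠ 0 ∧ g.coeff b ≠ 0 ∧ a + b = h := by
  obtain ⟨a, ha, b, hb, hab⟩ := Finset.mem_add.mp
    (AddMonoidAlgebra.support_coeff_mul_subset f g (Finsupp.mem_support_iff.mpr hh))
  exact ⟨a, b, Finsupp.mem_support_iff.mp ha, Finsupp.mem_support_iff.mp hb, hab⟩

/-- The subring of the elements all of whose terms have nonnegative `χ`-degree. -/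
def nonnegPart (R : Type*) [CommRing R] (χ : H →+ ℝ) : Subring (AddMonoidAlgebra R H) where
  carrier := {f | ∀ h, f.coeff h ≠ 0 → 0 ≤ χ h}
  zero_mem' := fun h hh => absurd rfl hh
  one_mem' := by
    intro h hh
    by_cases h0 : h = 0
    · rw [h0, map_zero]
    · exact absurd (Finsupp.single_eq_of_ne h0) hh
  add_mem' := by
    intro f g hf hg h hh
    by_cases h0 : f.coeff h = 0
    · exact hg h fun h1 => hh (by rw [AddMonoidAlgebra.coeff_add, Finsupp.add_apply, h0, h1,
        add_zero])
    · exact hf h h0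
  neg_mem' := by
    intro f hf h hh
    exact hf h fun h0 => hh (by rw [AddMonoidAlgebra.coeff_neg, Finsupp.neg_apply, h0, neg_zero])
  mul_mem' := by
    intro f g hf hg h hh
    obtain ⟨a, b, ha, hb, rfl⟩ := exists_coeff_ne_zero_of_mul hh
    rw [map_add]
    exact add_nonneg (hf a ha) (hg b hb)

theorem mul_mem_posPart {R : Type*} [CommRing R] {χ : H →+ ℝ} {f g : AddMonoidAlgebra R H}
    (hf : f ∈ nonnegPart R χ) (hg : g ∈ posPart R χ) : f * g ∈ posPart R χ := by
  intro h hh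
  obtain ⟨a, b, ha, hb, rfl⟩ := exists_coeff_ne_zero_of_mul hh
  rw [map_add]
  exact add_pos_of_nonneg_of_pos (hf a ha) (hg b hb)

theorem posPart_le_nonnegPart {R : Type*} [CommRing R] {χ : H →+ ℝ} {f : AddMonoidAlgebra R H}
    (hf : f ∈ posPart R χ) : f ∈ nonnegPart R χ :=
  fun h hh => (hf h hh).le

theorem isOneAddPos_of_sub_one_mem {R : Type*} [CommRing R] {χ : H →+ ℝ}
    {f : AddMonoidAlgebra R H} (hf : f - 1 ∈ posPart R χ) : IsOneAddPos χ f := by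
  have h1 : ∀ h, (f - 1).coeff h = f.coeff h - Finsupp.single 0 1 h := fun h => by
    rw [AddMonoidAlgebra.coeff_sub, Finsupp.sub_apply]; rfl
  constructor
  · by_contra hc
    refine absurd (hf 0 ?_) (by rw [map_zero]; exact lt_irrefl _)
    rw [h1, Finsupp.single_eq_same]
    exact sub_ne_zero.mpr hc
  · intro h hh h0
    refine hf h ?_
    rwa [h1, Finsupp.single_eq_of_ne h0, sub_zero]

/-- The multiplicative set of the elements `1 + g`, where all terms of `g` have positive
`χ`-degree. -/
def oneAddPos (R : Type*) [CommRing R] (χ : H →+ ℝ) : Submonoid (AddMonoidAlgebra R H) where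
  carrier := {f | f - 1 ∈ posPart R χ}
  one_mem' := by
    rw [Set.mem_ofPred_eq, sub_self]
    exact zero_mem _
  mul_mem' := by
    intro f g hf hg
    have h1 : f * g - 1 = (f - 1) * (g - 1) + ((f - 1) + (g - 1)) := by ring
    rw [Set.mem_ofPred_eq, h1]
    exact add_mem (mul_mem_posPart (posPart_le_nonnegPart hf) hg) (add_mem hf hg)

/-- A character in the tropical variety of `I` is dominated by a valuation of a field over
`R[H] ⧸ I`. -/
theorem exists_valuationSubring_of_mem_tropRing {R : Type*} [CommRing R] [Nontrivial R]
    {I : Ideal (AddMonoidAlgebra R H)} {χ : H →+ ℝ} (hχ : χ ∈ tropRing I) :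
    ∃ (P : Ideal (AddMonoidAlgebra R H)) (_ : P.IsPrime)
      (V : ValuationSubring (FractionRing (AddMonoidAlgebra R H ⧸ P)))
      (π : AddMonoidAlgebra R H →+* FractionRing (AddMonoidAlgebra R H ⧸ P)),
      (∀ f ∈ I, π f = 0) ∧ (∀ f ∈ nonnegPart R χ, V.valuation (π f) ≤ 1) ∧
        ∀ f ∈ posPart R χ, V.valuation (π f) < 1 := by
  have hdisj : Disjoint (I : Set (AddMonoidAlgebra R H)) (oneAddPos R χ) := by
    rw [Set.disjoint_left]
    exact fun f hf hf' => notMem_tropRing_iff.mpr ⟨f, hf, isOneAddPos_of_sub_one_mem hf'⟩ hχ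
  obtain ⟨P, hP, hIP, hPdisj⟩ := Ideal.exists_le_prime_disjoint I _ hdisj
  set K := FractionRing (AddMonoidAlgebra R H ⧸ P) with hK
  let π : AddMonoidAlgebra R H →+* K := (algebraMap _ K).comp (Ideal.Quotient.mk P)
  have hπ : ∀ f, π f = 0 ↔ f ∈ P := fun f => by
    rw [RingHom.comp_apply, FaithfulSMul.algebraMap_eq_zero_iff, Ideal.Quotient.eq_zero_iff_mem]
  -- This ideal is proper: if a positive g mapped to 1, then 1 - g would lie both in P and in the
  -- multiplicative set that P avoids.
  let 𝔪 : Ideal ((nonnegPart R χ).map π) :=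
    { carrier := {x | ∃ g ∈ posPart R χ, π g = x}
      zero_mem' := ⟨0, zero_mem _, map_zero π⟩
      add_mem' := by
        rintro x y ⟨f, hf, hfx⟩ ⟨g, hg, hgy⟩
        exact ⟨f + g, add_mem hf hg, by rw [map_add, hfx, hgy]; rfl⟩
      smul_mem' := by
        rintro ⟨_, f, hf, rfl⟩ y ⟨g, hg, hgy⟩
        exact ⟨f * g, mul_mem_posPart hf hg, by rw [map_mul, hgy]; rfl⟩ }
  have h𝔪 : 𝔪 ≠ ⊤ := by
    rw [Ideal.ne_top_iff_one]
    rintro ⟨g, hg, hg1⟩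
    have hmem : 1 - g ∈ P := by
      rw [← hπ, map_sub, hg1, map_one]
      exact sub_self _
    refine Set.disjoint_left.mp hPdisj hmem ?_
    change 1 - g - 1 ∈ posPart R χ
    rw [sub_sub_cancel_left]
    exact neg_mem hg
  obtain ⟨V, hV, hV'⟩ := Ideal.image_subset_nonunits_valuationSubring 𝔪 h𝔪
  refine ⟨P, hP, V, π, fun f hf => (hπ f).mpr (hIP hf), fun f hf => ?_, fun f hf => ?_⟩
  · exact (V.valuation_le_one_iff _).mpr (hV ⟨f, hf, rfl⟩)
  · exact (ValuationSubring.mem_nonunits_iff V).mp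
      (hV' ⟨⟨π f, f, posPart_le_nonnegPart hf, rfl⟩, ⟨f, hf, rfl⟩, rfl⟩)

end Valuation

/-! ### Comparing the values of primes with those of group elements. -/

section Dominated

variable {H : Type*} [AddCommGroup H] {Γ₀ : Type*} [LinearOrderedCommGroupWithZero Γ₀]

/-- A valuation `N` on `ℤ` and a homomorphism `W : H → Γ₀` compatible with `χ`, for which no
element of `I` has a dominant term. -/
structure IsDominated (I : Ideal (AddMonoidAlgebra ℤ H)) (χ : H →+ ℝ) (N : Valuation ℤ Γ₀)
    (W : H → Γ₀) : Prop where
  le_one : ∀ n, N n ≤ 1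
  map_zero : W 0 = 1
  map_add : ∀ g h, W (g + h) = W g * W h
  lt_one : ∀ h, 0 < χ h → W h < 1
  map_le_one : ∀ h, 0 ≤ χ h → W h ≤ 1
  not_dominant : ∀ f ∈ I, ∀ u, N (f.coeff u) ≠ 0 →
    ∃ u', u' ≠ u ∧ f.coeff u' ≠ 0 ∧ N (f.coeff u) * W u ≤ N (f.coeff u') * W u'

/-- A vanishing sum in a valued field has no strictly dominant term; this is applied to the
expansion of π f = 0 into monomials. -/
theorem exists_isDominated {I : Ideal (AddMonoidAlgebra ℤ H)} {χ : H →+ ℝ} {K : Type*} [Field K]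
    (w : Valuation K Γ₀) (π : AddMonoidAlgebra ℤ H →+* K) (hI : ∀ f ∈ I, π f = 0)
    (hle : ∀ f ∈ nonnegPart ℤ χ, w (π f) ≤ 1) (hlt : ∀ f ∈ posPart ℤ χ, w (π f) < 1) :
    IsDominated I χ (w.comap (Int.castRingHom K))
      fun h => w (π (AddMonoidAlgebra.single h 1)) := by
  have hadd : ∀ g h, w (π (AddMonoidAlgebra.single (g + h) 1)) =
      w (π (AddMonoidAlgebra.single g 1)) * w (π (AddMonoidAlgebra.single h 1)) := fun g h => by
    rw [← map_mul, ← map_mul, AddMonoidAlgebra.single_mul_single, one_mul]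
  have hzero : w (π (AddMonoidAlgebra.single 0 1)) = 1 := by
    rw [← AddMonoidAlgebra.one_def, map_one, map_one]
  have hpos : ∀ h, w (π (AddMonoidAlgebra.single h 1)) ≠ 0 := fun h h0 => by
    have := hadd h (-h)
    rw [add_neg_cancel, hzero, h0, zero_mul] at this
    exact one_ne_zero this
  have hsingle : ∀ (h g : H), (AddMonoidAlgebra.single h (1 : ℤ)).coeff g ≠ 0 → g = h :=
    fun h g hg => by_contra fun hne => hg (Finsupp.single_eq_of_ne hne)
  refine ⟨fun n => ?_, hzero, hadd, fun h hh => ?_, fun h hh => ?_, fun f hf u hu => ?_⟩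
  · rw [Valuation.comap_apply, eq_intCast, ← map_intCast π n]
    exact hle _ (intCast_mem _ n)
  · exact hlt _ fun g hg => hsingle h g hg ▸ hh
  · exact hle _ fun g hg => hsingle h g hg ▸ hh
  · by_contra hcon
    push Not at hcon
    have hsum : ∀ f, π f =
        ∑ h ∈ f.coeff.support, (f.coeff h : K) * π (AddMonoidAlgebra.single h 1) := by
      intro f
      conv_lhs => rw [← AddMonoidAlgebra.sum_coeff_single f, Finsupp.sum, map_sum]
      refine Finset.sum_congr rfl fun h _ => ?_
      rw [← map_intCast π, ← map_mul, ← zsmul_eq_mul, AddMonoidAlgebra.smul_single, smul_eq_mul,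
        mul_one]
    have hus : u ∈ f.coeff.support := by
      rw [Finsupp.mem_support_iff]
      intro h0
      exact hu (by rw [h0, map_zero])
    have hval : ∀ h, w ((f.coeff h : K) * π (AddMonoidAlgebra.single h 1)) =
        w.comap (Int.castRingHom K) (f.coeff h) * w (π (AddMonoidAlgebra.single h 1)) :=
      fun h => map_mul _ _ _
    have h0 := hsum f
    rw [hI f hf, ← Finset.add_sum_erase _ _ hus] at h0
    have hlt' := w.map_sum_lt (s := f.coeff.support.erase u)
      (f := fun h => (f.coeff h : K) * π (AddMonoidAlgebra.single h 1))
      (g := w ((f.coeff u : K) * π (AddMonoidAlgebra.single u 1)))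
      (by rw [hval]; exact mul_ne_zero hu (hpos u)) fun h hh => by
        rw [hval, hval]
        exact hcon h (Finset.ne_of_mem_erase hh)
          (Finsupp.mem_support_iff.mp (Finset.mem_of_mem_erase hh))
    rw [eq_neg_of_add_eq_zero_left h0.symm, Valuation.map_neg] at hlt'
    exact lt_irrefl _ hlt'

namespace IsDominated

variable {I : Ideal (AddMonoidAlgebra ℤ H)} {χ : H →+ ℝ} {N : Valuation ℤ Γ₀} {W : H → Γ₀}

theorem pos (D : IsDominated I χ N W) (h : H) : 0 < W h := by
  refine zero_lt_iff.mpr fun h0 => ?_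
  have := D.map_add h (-h)
  rw [add_neg_cancel, D.map_zero, h0, zero_mul] at this
  exact one_ne_zero this

theorem map_nsmul (D : IsDominated I χ N W) (n : ℕ) (h : H) : W (n • h) = W h ^ n := by
  induction n with
  | zero => rw [zero_smul, pow_zero, D.map_zero]
  | succ n ih => rw [succ_nsmul, D.map_add, ih, pow_succ]

theorem eq_mul_sub (D : IsDominated I χ N W) (g h : H) : W h = W g * W (h - g) := by
  rw [← D.map_add, add_sub_cancel]

theorem lt_of_lt (D : IsDominated I χ N W) {g h : H} (hgh : χ g < χ h) : W h < W g := by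
  rw [D.eq_mul_sub g h]
  exact mul_lt_of_lt_one_right (D.pos g) (D.lt_one _ (by rw [_root_.map_sub]; linarith))

theorem le_of_le (D : IsDominated I χ N W) {g h : H} (hgh : χ g ≤ χ h) : W h ≤ W g := by
  rw [D.eq_mul_sub g h]
  exact mul_le_of_le_one_right' (D.map_le_one _ (by rw [_root_.map_sub]; linarith))

/-- At most one prime has value smaller than `1`. -/
theorem eq_one_of_not_dvd (D : IsDominated I χ N W) {p : Nat.Primes} (hp : N (p : ℕ) < 1) {a : ℤ}
    (ha : ¬ ((p : ℕ) : ℤ) ∣ a) : N a = 1 := by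
  obtain ⟨x, y, hxy⟩ := (Prime.coprime_iff_not_dvd (Nat.prime_iff_prime_int.mp p.2)).mpr ha
  refine le_antisymm (D.le_one a) (not_lt.mp fun hlt => ?_)
  have h1 : N (x * (p : ℕ) + y * a) < 1 := by
    refine N.map_add_lt ?_ ?_ <;> rw [map_mul]
    · exact (mul_le_of_le_one_left' (D.le_one x)).trans_lt hp
    · exact (mul_le_of_le_one_left' (D.le_one y)).trans_lt hlt
  rw [hxy, map_one] at h1
  exact lt_irrefl _ h1

variable {h₀ : H}

/-- If `N p` and `W h₀` are commensurable, then `N p` acts as the value of an element of real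
degree `t`. -/
theorem exists_slope (D : IsDominated I χ N W) (hh₀ : 0 < χ h₀) {q : Γ₀} {m n : ℕ}
    (hm : q ^ m ≤ W h₀) (hn : W h₀ ^ n ≤ q) :
    ∃ t : ℝ, 0 < t ∧ (∀ (e : ℕ) (h : H), χ h < e * t → q ^ e < W h) ∧
      ∀ (e : ℕ) (h : H), e * t < χ h → W h < q ^ e := by
  have hW1 := D.lt_one h₀ hh₀
  have hm0 : 0 < m := Nat.pos_of_ne_zero fun h0 => by
    rw [h0, pow_zero] at hm
    exact not_lt.mpr hm hW1
  -- The slope t is the supremum of the ratios χ h / b for which h is no smaller in value than q ^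
  -- b: a Dedekind cut for the degree of q. The bound hn makes the set bounded, and hm puts χ h₀ / m
  -- > 0 in it.
  set S : Set ℝ := {x | ∃ (h : H) (b : ℕ), 0 < b ∧ q ^ b ≤ W h ∧ x = χ h / b} with hS
  have hbdd : BddAbove S := by
    refine ⟨n * χ h₀, ?_⟩
    rintro _ ⟨h, b, hb, hqb, rfl⟩
    rw [div_le_iff₀ (by exact_mod_cast hb)]
    by_contra hlt
    refine not_lt.mpr hqb ((D.lt_of_lt (g := (n * b) • h₀) ?_).trans_le ?_)
    · rw [_root_.map_nsmul, nsmul_eq_mul]; push_cast; linarith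
    · rw [D.map_nsmul, pow_mul]
      exact pow_le_pow_left₀ zero_le hn b
  have hmem : ∀ (h : H) (b : ℕ), 0 < b → q ^ b ≤ W h → χ h / b ≤ sSup S :=
    fun h b hb hq => le_csSup hbdd ⟨h, b, hb, hq, rfl⟩
  refine ⟨sSup S, ?_, fun e h he => ?_, fun e h he => ?_⟩
  · exact (div_pos hh₀ (by exact_mod_cast hm0)).trans_le (hmem h₀ m hm0 hm)
  · rcases Nat.eq_zero_or_pos e with rfl | he0
    · rw [pow_zero, ← D.map_zero]
      exact D.lt_of_lt (by simpa using he)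
    have he' : (0 : ℝ) < e := by exact_mod_cast he0
    obtain ⟨_, ⟨g, b, hb, hqb, rfl⟩, hlt⟩ := exists_lt_of_lt_csSup
      (show S.Nonempty from ⟨_, h₀, m, hm0, hm, rfl⟩) ((div_lt_iff₀' he').mpr he)
    have hb' : (0 : ℝ) < b := by exact_mod_cast hb
    rw [div_lt_div_iff₀ he' hb'] at hlt
    -- Cross-multiplied: q ^ (b * e) ≤ W (e • g) < W (b • h), the last step since b χ(h) < e χ(g).
    have h1 : (q ^ e) ^ b < W h ^ b := by
      rw [← pow_mul, mul_comm, pow_mul, ← D.map_nsmul b h]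
      refine (pow_le_pow_left₀ zero_le hqb e).trans_lt ?_
      rw [← D.map_nsmul]
      refine D.lt_of_lt ?_
      rw [_root_.map_nsmul, _root_.map_nsmul, nsmul_eq_mul, nsmul_eq_mul]
      linarith
    exact lt_of_pow_lt_pow_left₀ b zero_le h1
  · rcases Nat.eq_zero_or_pos e with rfl | he0
    · rw [pow_zero]
      exact D.lt_one h (by simpa using he)
    by_contra hle
    have := hmem h e he0 (not_lt.mp hle)
    rw [div_le_iff₀' (by exact_mod_cast he0)] at this
    exact not_lt.mpr this he

variable [AddGroup.FG H]

/-- By multiplicativity all nonzero integers have values infinitely closer to 1 than W h₀. A unique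
minimum at u would force, through some competing u', N(coefficient) ≤ W(u' - u) with χ(u' - u) > 0;
a multiple of u' - u passes h₀, which is impossible. -/
theorem mem_tropField_trivialVal_rat (D : IsDominated I χ N W) (hh₀ : 0 < χ h₀)
    (hp : ∀ (p : Nat.Primes) (n : ℕ), W h₀ < N (p : ℕ) ^ n) :
    χ ∈ tropField (trivialVal ℚ) (extendIdeal ℚ I) := by
  have hnat : ∀ a : ℕ, a ≠ 0 → ∀ n : ℕ, W h₀ < N a ^ n := by
    intro a
    induction a using induction_on_primes with
    | zero => exact fun h => absurd rfl h
    | one => intro _ n; rw [Nat.cast_one, map_one, one_pow]; exact D.lt_one _ hh₀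
    | prime_mul p a hpp ih =>
      intro h0 n
      -- The value of the product is at least the square of the smaller factor, hence the doubled
      -- exponent.
      have h1 := hp ⟨p, hpp⟩ (2 * n)
      have h2 := ih (right_ne_zero_of_mul h0) (2 * n)
      rw [Nat.cast_mul, map_mul]
      rcases le_total (N (p : ℤ)) (N (a : ℤ)) with h | h
      · refine h1.trans_le ?_
        rw [pow_mul, sq]
        exact pow_le_pow_left₀ zero_le (mul_le_mul_right h _) n
      · refine h2.trans_le ?_
        rw [pow_mul, sq]
        exact pow_le_pow_left₀ zero_le (mul_le_mul_left h _) n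
  have hint : ∀ a : ℤ, a ≠ 0 → ∀ n : ℕ, W h₀ < N a ^ n := by
    intro a ha n
    rcases Int.natAbs_eq a with h | h <;> rw [h]
    · exact hnat _ (Int.natAbs_ne_zero.mpr ha) n
    · rw [Valuation.map_neg]; exact hnat _ (Int.natAbs_ne_zero.mpr ha) n
  by_contra hcon
  obtain ⟨F, hF, u, hu, hlt⟩ := notMem_tropField_trivialVal_extendIdeal_rat_iff.mp hcon
  have hN : N (F.coeff u) ≠ 0 := fun h0 => by
    have := hint _ hu 1
    rw [pow_one, h0] at this
    exact not_lt_zero this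
  obtain ⟨u', hne, hu', hle⟩ := D.not_dominant F hF u hN
  have hχ := hlt u' hu' hne
  have h1 : N (F.coeff u) ≤ W (u' - u) := by
    rw [D.eq_mul_sub u u', mul_left_comm, mul_comm (N _)] at hle
    exact ((mul_le_mul_iff_right₀ (D.pos u)).mp hle).trans
      (mul_le_of_le_one_left' (D.le_one _))
  obtain ⟨n, hn⟩ := Archimedean.arch (χ h₀) (sub_pos.mpr hχ)
  refine not_le.mpr (hint _ hu n) ((pow_le_pow_left₀ zero_le h1 n).trans ?_)
  rw [← D.map_nsmul]
  exact D.le_of_le (by rwa [_root_.map_nsmul, _root_.map_sub])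

/-- Coefficients divisible by p are too small for any bounded degree difference to compensate, and
all others have value 1, so only the reduction mod p counts. The value N p = 0 is allowed. -/
theorem mem_tropField_zmod (D : IsDominated I χ N W) (hh₀ : 0 < χ h₀) {p : Nat.Primes}
    (hp : ∀ n : ℕ, N (p : ℕ) < W h₀ ^ n) :
    χ ∈ tropField (trivialVal (ZMod p)) (extendIdeal (ZMod p) I) := by
  have hp1 : N (p : ℕ) < 1 := by simpa using hp 0
  by_contra hcon
  obtain ⟨F, hF, u, hu, hlt⟩ := notMem_tropField_extendIdeal_zmod_iff.mp hcon
  obtain ⟨u', hne, hu', hle⟩ := D.not_dominant F hF u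
    (by rw [D.eq_one_of_not_dvd hp1 hu]; exact one_ne_zero)
  rw [D.eq_one_of_not_dvd hp1 hu, one_mul] at hle
  by_cases hdvd : ((p : ℕ) : ℤ) ∣ F.coeff u'
  · obtain ⟨b, hb⟩ := hdvd
    obtain ⟨n, hn⟩ := Archimedean.arch (χ u - χ u') hh₀
    have h1 : N (F.coeff u') ≤ N (p : ℕ) := by
      rw [hb, map_mul]
      exact mul_le_of_le_one_right' (D.le_one b)
    have h2 : W (n • h₀ + u') ≤ W u :=
      D.le_of_le (by rw [_root_.map_add, _root_.map_nsmul]; linarith)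
    rw [D.map_add, D.map_nsmul] at h2
    exact not_lt.mpr (hle.trans (mul_le_mul_left h1 _))
      ((mul_lt_mul_of_pos_right (hp n) (D.pos u')).trans_le h2)
  · rw [D.eq_one_of_not_dvd hp1 hdvd, one_mul] at hle
    exact not_lt.mpr hle (D.lt_of_lt (hlt u' hdvd hne))

/-- On the scale of χ the prime p has degree t, while v_p(p) = 1; the factor c = t⁻¹ reconciles the
two. A strict real inequality between terms then becomes a strict inequality of values, so a unique
minimum would be a dominant term. -/
theorem exists_smul_mem_tropField_padicVal (D : IsDominated I χ N W) (hh₀ : 0 < χ h₀)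
    {p : Nat.Primes} {m n : ℕ} (hm : N (p : ℕ) ^ m ≤ W h₀) (hn : W h₀ ^ n ≤ N (p : ℕ)) :
    ∃ c : ℝ, 0 < c ∧ c • χ ∈ tropField (padicVal p) (extendIdeal ℚ I) := by
  obtain ⟨t, ht, hlow, hhigh⟩ := D.exists_slope hh₀ hm hn
  have hp1 : N (p : ℕ) < 1 := by
    refine lt_of_le_of_ne (D.le_one _) fun h => ?_
    rw [h, one_pow] at hm
    exact not_lt.mpr hm (D.lt_one _ hh₀)
  have hq0 : 0 < N (p : ℕ) := (pow_pos (D.pos h₀) n).trans_le hn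
  have hval : ∀ a : ℤ, a ≠ 0 → N a = N (p : ℕ) ^ padicValInt p a := by
    intro a ha
    obtain ⟨b, hb⟩ := padicValInt_dvd (p := p) a
    have hnd : ¬ ((p : ℕ) : ℤ) ∣ b := by
      rintro ⟨d, rfl⟩
      have : ((p : ℕ) : ℤ) ^ (padicValInt p a + 1) ∣ a := ⟨d, by rw [pow_succ, mul_assoc]; exact hb⟩
      rcases (padicValInt_dvd_iff _ a).mp this with h | h
      · exact ha h
      · omega
    conv_lhs => rw [hb, map_mul, map_pow, D.eq_one_of_not_dvd hp1 hnd, mul_one]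
  refine ⟨t⁻¹, inv_pos.mpr ht, ?_⟩
  by_contra hcon
  obtain ⟨F, hF, u, hu, hlt⟩ := notMem_tropField_padicVal_extendIdeal_rat_iff.mp hcon
  obtain ⟨u', hne, hu', hle⟩ := D.not_dominant F hF u
    (by rw [hval _ hu]; exact pow_ne_zero _ hq0.ne')
  rw [hval _ hu, hval _ hu'] at hle
  have hlt' := hlt u' hu' hne
  generalize padicValInt p (F.coeff u) = r at *
  generalize padicValInt p (F.coeff u') = s at *
  have hreal : r * t + χ u < s * t + χ u' := by
    have h1 : ∀ x : H, (t⁻¹ • χ) x = t⁻¹ * χ x := fun x => rfl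
    rw [h1, h1] at hlt'
    have h2 := mul_lt_mul_of_pos_right hlt' ht
    have h3 : ∀ x : ℝ, t⁻¹ * x * t = x := fun x => by field_simp
    rwa [add_mul, add_mul, h3, h3] at h2
  refine not_lt.mpr hle ?_
  rcases le_total r s with h | h
  · obtain ⟨e, rfl⟩ := Nat.exists_eq_add_of_le h
    rw [pow_add, mul_assoc, D.eq_mul_sub u' u, mul_comm (W u')]
    refine mul_lt_mul_of_pos_left (mul_lt_mul_of_pos_right (hlow e _ ?_) (D.pos u'))
      (pow_pos hq0 r)
    push_cast at hreal
    rw [_root_.map_sub]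
    linarith
  · obtain ⟨e, rfl⟩ := Nat.exists_eq_add_of_le h
    rw [pow_add, mul_assoc, D.eq_mul_sub u u', mul_comm (W u)]
    refine mul_lt_mul_of_pos_left (mul_lt_mul_of_pos_right (hhigh e _ ?_) (D.pos u))
      (pow_pos hq0 s)
    push_cast at hreal
    rw [_root_.map_sub]
    linarith

end IsDominated

/-- The three cases compare the archimedean class of W h₀ with those of the N p; χ ≠ 0 is needed to
have an h₀ of positive degree. -/
theorem exists_smul_mem_tropUnion [AddGroup.FG H] {I : Ideal (AddMonoidAlgebra ℤ H)} {χ : H →+ ℝ}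
    (hχ : χ ∈ tropRing I) (hχ0 : χ ≠ 0) : ∃ c : ℝ, 0 < c ∧ c • χ ∈ tropUnion I Set.univ := by
  obtain ⟨P, hP, V, π, hI, hle, hlt⟩ := exists_valuationSubring_of_mem_tropRing hχ
  have D := exists_isDominated V.valuation π hI hle hlt
  obtain ⟨h₀, hh₀⟩ : ∃ h₀, 0 < χ h₀ := by
    obtain ⟨h, hh⟩ := DFunLike.ne_iff.mp hχ0
    rcases lt_or_gt_of_ne hh with h' | h'
    · exact ⟨-h, by rw [map_neg]; exact neg_pos.mpr h'⟩
    · exact ⟨h, h'⟩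
  generalize V.valuation.comap (Int.castRingHom _) = N at D
  generalize (fun h => V.valuation (π (AddMonoidAlgebra.single h 1))) = W at D
  by_cases hA : ∀ (p : Nat.Primes) (n : ℕ), W h₀ < N (p : ℕ) ^ n
  · exact ⟨1, one_pos, Or.inl (by rw [one_smul]; exact D.mem_tropField_trivialVal_rat hh₀ hA)⟩
  push Not at hA
  obtain ⟨p, m, hm⟩ := hA
  by_cases hB : ∀ n : ℕ, N (p : ℕ) < W h₀ ^ n
  · refine ⟨1, one_pos, Or.inr (Set.mem_iUnion₂.mpr ⟨p, Set.mem_univ p, Or.inr ?_⟩)⟩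
    rw [one_smul]
    exact D.mem_tropField_zmod hh₀ hB
  · push Not at hB
    obtain ⟨n, hn⟩ := hB
    obtain ⟨c, hc, hcχ⟩ := D.exists_smul_mem_tropField_padicVal hh₀ hm hn
    exact ⟨c, hc, Or.inr (Set.mem_iUnion₂.mpr ⟨p, Set.mem_univ p, Or.inl hcχ⟩)⟩

end Dominated

theorem sphereProj_tropRing {H : Type*} [AddCommGroup H] [AddGroup.FG H]
    (I : Ideal (AddMonoidAlgebra ℤ H)) :
    sphereProj (tropRing I) = sphereProj (tropUnion I Set.univ) := by
  refine subset_antisymm ?_ ?_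
  · rintro _ ⟨χ, hχ0, hχ, rfl⟩
    obtain ⟨c, hc, hcχ⟩ := exists_smul_mem_tropUnion hχ hχ0
    exact ⟨c • χ, smul_ne_zero hc.ne' hχ0, hcχ,
      (ray_eq_iff _ _).mpr (SameRay.sameRay_pos_smul_left χ hc)⟩
  · rintro _ ⟨χ, hχ0, hχ, rfl⟩
    exact ⟨χ, hχ0, tropUnion_subset_tropRing I _ hχ, rfl⟩

end

theorem mainTheorem7 {H : Type*} [AddCommGroup H] [AddGroup.FG H]
    (I : Ideal (AddMonoidAlgebra ℤ H)) :
    sphereProj (tropRing I) = sphereProj (tropUnion I Set.univ) ∧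
      ∃ P : Set Nat.Primes, P.Finite ∧
        sphereProj (tropRing I) = sphereProj (tropUnion I P) := by
  obtain ⟨P, hP, hPI⟩ := exists_finite_tropUnion_eq I
  exact ⟨sphereProj_tropRing I, P, hP, hPI ▸ sphereProj_tropRing I⟩
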